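/- Let $\mathcal X,\mathcal Y,\mathcal S$ be finite sets, $\mathcal X\neq\emptyset$, and let $\mathcal P(\mathcal B\mid\mathcal A)$ denote the conditional probability distributions on $\mathcal B$ given an input in $\mathcal A$. A channel with state is a pair $N=(N_{Y|XS},P_S)$ with $N_{Y|XS}\in\mathcal P(\mathcal Y\mid\mathcal X\times\mathcal S)$ and a probability distribution $P_S$ on $\mathcal S$. Let $\bar N=(\bar N_{YS_R|XS},P_S)$, with $\bar N_{YS_R|XS}(y,s_R\mid x,s)=N_{Y|XS}(y\mid x,s)\,\mathbb I(s_R=s)$, be the channel whose output also contains the state, and let $N^{\otimes n}$ denote $n$ independent uses of $N$, with inputs in $\mathcal X^n$, outputs in $\mathcal Y^n$, states in $\mathcal S^n$ and product transition and state laws. A non-signaling (NS) assisted coding scheme with $M\ge 1$ messages is a conditional distribution $Z(x,\hat w\mid[w,s],y)$, with $w,\hat w\in[M]$, such that $\sum_{\hat w}Z(x,\hat w\mid[w,s],y)$ does not depend on $y$ and $\sum_xZ(x,\hat w\mid[w,s],y)$ does not depend on $(w,s)$. The scheme is classical if $Z(x,\hat w\mid[w,s],y)=\sum_qP_Q(q)E(x\mid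 w,s,q)D(\hat w\mid y,q)$ for a probability distribution $P_Q$ on a finite set, an encoder $E$ and a decoder $D$. Its probability of success is $$\eta(Z)=\frac1M\sum_{w,s,x,y}P_S(s)\,N_{Y|XS}(y\mid x,s)\,Z(x,w\mid[w,s],y).$$ A rate $R\ge0$ (in bits per channel use) is achievable over $N$ classically (with NS assistance) if there are classical (NS-assisted) schemes $Z_n$ with $M_n\ge 1$ messages for $N^{\otimes n}$ such that $\lim_n\eta(Z_n)=1$ and $\lim_n\frac1n\log_2M_n$ exists and is at least $R$. The classical capacity $C^{\rm C}(N)$ and the NS-assisted capacity $C^{\rm NS}(N)$ are the suprema of the rates achievable classically and with NS assistance, respectively. Note that the encoder has the whole state sequence $S^n$ as an input. Then, with $(S,X,Y)\sim P_S\,P_{X|S}\,N_{Y|XS}$ and mutual information in bits, $$C^{\rm NS}(N)=\max_{P_{X|S}\in\mathcal P(\mathcal X\mid\mathcal S)}I(X;Y\mid S)=C^{\rm C}(\bar N)=C^{\rm NS}(\bar N),$$ where the maximum is attained. Moreover, for every $M\ge1$ and every NS-assisted coding scheme $Z$ for $N$ with $M$ messages, $$I(X;Y\mid S)\ \ge\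 \eta(Z)\log_2M-H_b(\eta(Z)),$$ where $H_b$ is the binary entropy in bits and $(S,X,Y)$ has the joint law induced by $Z$, $$\Pr(S=s,X=x,Y=y)=\sum_{w,\hat w}\frac1M\,P_S(s)\,N_{Y|XS}(y\mid x,s)\,Z(x,\hat w\mid[w,s],y).$$ -/

import Mathlib

noncomputable section

open Filter Topology

/-- `𝒫(B ∣ A)`: conditional probability distributions on the finite set `B` given an input in `A`.
`W a b` is the probability of the output `b` given the input `a`. -/
def condPMF (A B : Type*) [Fintype B] : Set (A → B → ℝ) :=
  {W | ∀ a, W a ∈ stdSimplex ℝ B}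

/-- Bipartite non-signaling boxes `𝒫₂^NS(B₁, B₂ ∣ A₁, A₂)`: the marginal law of the output of either
party does not depend on the input of the other party. -/
def nsBoxes (B₁ B₂ A₁ A₂ : Type*) [Fintype B₁] [Fintype B₂] :
    Set (A₁ × A₂ → B₁ × B₂ → ℝ) :=
  {P | P ∈ condPMF (A₁ × A₂) (B₁ × B₂) ∧
    (∀ a₁ a₂ a₂' b₁, ∑ b₂, P (a₁, a₂) (b₁, b₂) = ∑ b₂, P (a₁, a₂') (b₁, b₂)) ∧
    (∀ a₁ a₁' a₂ b₂, ∑ b₁, P (a₁, a₂) (b₁, b₂) = ∑ b₁, P (a₁', a₂) (b₁, b₂))}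

/-- Conditional mutual information `I(X;Y∣S)`, in bits, of the joint law `p (s, x, y)`:
`∑ p(s,x,y) log₂ (p(s,x,y) p(s) / (p(s,x) p(s,y)))`. Terms with `p(s,x,y) = 0` contribute `0`; in all
other terms the denominator is positive. -/
def condMutualInfo {S X Y : Type*} [Fintype S] [Fintype X] [Fintype Y]
    (p : S × X × Y → ℝ) : ℝ :=
  ∑ s, ∑ x, ∑ y, p (s, x, y) *
    Real.logb 2 ((p (s, x, y) * ∑ x', ∑ y', p (s, x', y')) /
      ((∑ y', p (s, x, y')) * ∑ x', p (s, x', y)))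

/-- A channel with state: the transition law `N(y ∣ x, s)` and the law `P_S` of the state. -/
structure StateChannel (X Y S : Type*) [Fintype Y] [Fintype S] where
  kernel : X × S → Y → ℝ
  stateLaw : S → ℝ
  kernel_mem : kernel ∈ condPMF (X × S) Y
  stateLaw_mem : stateLaw ∈ stdSimplex ℝ S

/-- A product of probability vectors is a probability vector. -/
theorem prod_mem_stdSimplex {ι B : Type*} [Fintype ι] [DecidableEq ι] [Fintype B]
    (p : ι → B → ℝ) (hp : ∀ i, p i ∈ stdSimplex ℝ B) :
    (fun b : ι → B => ∏ i, p i (b i)) ∈ stdSimplex ℝ (ι → B) := by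
  refine ⟨fun b => Finset.prod_nonneg fun i _ => (hp i).1 _, ?_⟩
  rw [← Fintype.prod_sum]
  exact Finset.prod_eq_one fun i _ => (hp i).2

namespace StateChannel

variable {X Y S : Type*} [Fintype Y] [Fintype S]

/-- `n` independent uses of a channel with state. -/
def pow (N : StateChannel X Y S) (n : ℕ) :
    StateChannel (Fin n → X) (Fin n → Y) (Fin n → S) where
  kernel := fun xs y => ∏ i, N.kernel (xs.1 i, xs.2 i) (y i)
  stateLaw := fun s => ∏ i, N.stateLaw (s i)
  kernel_mem := fun xs => prod_mem_stdSimplex (fun i => N.kernel (xs.1 i, xs.2 i))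
    fun _ => N.kernel_mem _
  stateLaw_mem := prod_mem_stdSimplex (fun _ => N.stateLaw) fun _ => N.stateLaw_mem

/-- The channel `N̄`, whose output also contains a copy `s_R` of the state. -/
def bar [DecidableEq S] (N : StateChannel X Y S) : StateChannel X (Y × S) S where
  kernel := fun xs ys => N.kernel xs ys.1 * if ys.2 = xs.2 then 1 else 0
  stateLaw := N.stateLaw
  kernel_mem := by
    intro xs
    refine ⟨fun ys => mul_nonneg ((N.kernel_mem xs).1 _) (by split_ifs <;> norm_num), ?_⟩
    rw [Fintype.sum_prod_type]
    simpa using (N.kernel_mem xs).2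
  stateLaw_mem := N.stateLaw_mem

/-- The joint law `P_S(s) P(x ∣ s) N(y ∣ x, s)` of `(S, X, Y)` for an input law `P_{X∣S}`. -/
def jointLaw (N : StateChannel X Y S) (P : S → X → ℝ) : S × X × Y → ℝ :=
  fun t => N.stateLaw t.1 * P t.1 t.2.1 * N.kernel (t.2.1, t.1) t.2.2

end StateChannel

/-- The space in which coding schemes `Z(x, ŵ ∣ [w, s], y)` with message set `Fin M` live. -/
abbrev Scheme (X Y S : Type*) (M : ℕ) : Type _ :=
  (Fin M × S) × Y → X × Fin M → ℝ

/-- Non-signaling assisted coding schemes. -/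
def nsSchemes (X Y S : Type*) [Fintype X] (M : ℕ) : Set (Scheme X Y S M) :=
  nsBoxes X (Fin M) (Fin M × S) Y

/-- Classical coding schemes: an encoder and a decoder that share a finite random variable `Q`
with law `PQ`. -/
def classicalSchemes (X Y S : Type*) [Fintype X] (M : ℕ) : Set (Scheme X Y S M) :=
  {Z | ∃ (Q : Type) (_ : Fintype Q) (PQ : Q → ℝ) (E : Fin M × S × Q → X → ℝ)
      (D : Y × Q → Fin M → ℝ),
    PQ ∈ stdSimplex ℝ Q ∧ E ∈ condPMF (Fin M × S × Q) X ∧ D ∈ condPMF (Y × Q) (Fin M) ∧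
    ∀ w s y x w', Z ((w, s), y) (x, w') = ∑ q, PQ q * E (w, s, q) x * D (y, q) w'}

namespace StateChannel

variable {X Y S : Type*} [Fintype X] [Fintype Y] [Fintype S]

/-- Probability of success `η(Z) = Pr(W = Ŵ)`, for a uniformly distributed message `W`. -/
def successProb (N : StateChannel X Y S) {M : ℕ} (Z : Scheme X Y S M) : ℝ :=
  (1 / (M : ℝ)) * ∑ w, ∑ s, ∑ x, ∑ y,
    N.stateLaw s * N.kernel (x, s) y * Z ((w, s), y) (x, w)

/-- The joint law of `(S, X, Y)` when the scheme `Z` is used over the channel, that is, the marginal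
of the law `(1/M) P_S(s) N(y ∣ x, s) Z(x, ŵ ∣ [w, s], y)` of `(W, Ŵ, S, X, Y)`. -/
def inducedLaw (N : StateChannel X Y S) {M : ℕ} (Z : Scheme X Y S M) : S × X × Y → ℝ :=
  fun t => ∑ w, ∑ w', (1 / (M : ℝ)) * N.stateLaw t.1 * N.kernel (t.2.1, t.1) t.2.2 *
    Z ((w, t.1), t.2.2) (t.2.1, w')

/-- The rate `R ≥ 0`, in bits per channel use, is achieved by a sequence of coding schemes `Z n` with
`M n` messages for `n` channel uses, taken from the classes `𝒵 n (M n)`. -/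
def IsAchievable (N : StateChannel X Y S)
    (𝒵 : ∀ n M : ℕ, Set (Scheme (Fin n → X) (Fin n → Y) (Fin n → S) M)) (R : ℝ) : Prop :=
  0 ≤ R ∧ ∃ (M : ℕ → ℕ) (Z : ∀ n, Scheme (Fin n → X) (Fin n → Y) (Fin n → S) (M n)) (L : ℝ),
    (∀ n, 0 < M n) ∧ (∀ n, Z n ∈ 𝒵 n (M n)) ∧
    Tendsto (fun n => (N.pow n).successProb (Z n)) atTop (𝓝 1) ∧
    Tendsto (fun n : ℕ => Real.logb 2 (M n) / n) atTop (𝓝 L) ∧ R ≤ L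

/-- Classical capacity: supremum of the classically achievable rates. The supremum is taken in the
extended reals, so that it is meaningful without knowing that the set is bounded or nonempty. -/
def classicalCapacity (N : StateChannel X Y S) : EReal :=
  sSup ((fun R : ℝ => (R : EReal)) '' {R | N.IsAchievable (fun _ M => classicalSchemes _ _ _ M) R})

/-- NS-assisted capacity: supremum of the rates that are achievable with NS assistance. -/
def nsCapacity (N : StateChannel X Y S) : EReal :=
  sSup ((fun R : ℝ => (R : EReal)) '' {R | N.IsAchievable (fun _ M => nsSchemes _ _ _ M) R})

end StateChannel

end

/-!
# Capacities of a channel with state known to the encoder, with non-signaling assistance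

A non-signaling scheme enters its success probability only through two kernels: the probability
`p(x∣s)` of emitting `x` and the probability `r_s(x,y) ≤ p(x∣s)` of emitting `x` and decoding
correctly, for a uniform message. Non-signaling from the encoder to the decoder says that
`∑ₓ r_s(x,y) = 1 / M`.

*Hiding the state.* Conversely, any such pair comes from a non-signaling scheme which is symmetric
in the messages (`Scheme.hideState`). These constraints are imposed for each state separately and
only the pairs in which the decoder sees the true state matter, so a decoder that sees the state
has no advantage. Hence `N.bar.nsCapacity ≤ N.nsCapacity`
(`StateChannel.nsCapacity_bar_le`).

*Converse.* If the channel output is redrawn independently of the input given the state, then the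
scheme succeeds with probability `∑ P_S(s) P(y∣s) r_s(x,y) = 1 / M`. The relative entropy between
the true law and this one is `I(X;Y∣S)`, so it dominates the relative entropy of the success events,
which is at least `η log M - H_b(η)` (`StateChannel.successProb_mul_logb_le`). For `n` uses,
`I(Xⁿ;Yⁿ∣Sⁿ)` is at most the sum of the mutual informations of the letters
(`StateChannel.condMutualInfo_pow_le_sum`), which bounds `N.nsCapacity`.

*Achievability.* Over `N.bar` the decoder reads off the state, so random coding with code words
drawn from `P(·∣s)` for each message and state sequence, and a decoder that looks for a large
likelihood ratio, achieves all rates below `I(X;Y∣S)`. Classical schemes are allowed shared randomness, so the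
random codebook itself is shared and nothing needs to be derandomized
(`StateChannel.exists_classicalScheme`, `StateChannel.isAchievable_bar`).

These close the circle `max I ≤ N.bar.classicalCapacity ≤ N.bar.nsCapacity ≤ N.nsCapacity ≤ max I`.
-/

open Filter Topology

/-! ### Product laws on finite sets -/

section ProductLaws

variable {ι B : Type*} [Fintype ι] [DecidableEq ι] [Fintype B]

theorem sum_prod_mul_prod (p h : ι → B → ℝ) :
    ∑ b : ι → B, (∏ k, p k (b k)) * ∏ k, h k (b k) = ∏ k, ∑ c, p k c * h k c := by
  rw [Fintype.prod_sum]
  exact Finset.sum_congr rfl fun b _ => Finset.prod_mul_distrib.symm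

theorem sum_prod_mul_apply {p : ι → B → ℝ} (hp : ∀ i, p i ∈ stdSimplex ℝ B) (i : ι)
    (F : B → ℝ) : ∑ b : ι → B, (∏ k, p k (b k)) * F (b i) = ∑ c, p i c * F c := by
  have key := sum_prod_mul_prod p (fun k c => if k = i then F c else 1)
  simp only [Finset.prod_ite_eq', Finset.mem_univ, if_true] at key
  rw [key, Finset.prod_eq_single i (fun k _ hk => by simp [hk, (hp k).2]) (by simp)]
  simp

theorem sum_prod_mul_apply_mul_apply {p : ι → B → ℝ} (hp : ∀ i, p i ∈ stdSimplex ℝ B)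
    {i j : ι} (hij : i ≠ j) (F G : B → ℝ) :
    ∑ b : ι → B, (∏ k, p k (b k)) * (F (b i) * G (b j)) =
      (∑ c, p i c * F c) * ∑ c, p j c * G c := by
  have key := sum_prod_mul_prod p
    (fun k c => (if k = i then F c else 1) * (if k = j then G c else 1))
  simp only [Finset.prod_mul_distrib, Finset.prod_ite_eq', Finset.mem_univ, if_true] at key
  rw [key, ← Finset.mul_prod_erase _ _ (Finset.mem_univ i),
    Finset.prod_eq_single j
      (fun k hk hkj => by simp [(Finset.mem_erase.1 hk).1, hkj, (hp k).2])
      (fun h => absurd (Finset.mem_erase.2 ⟨hij.symm, Finset.mem_univ j⟩) h)]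
  simp [hij, hij.symm]

/-- The variance of a sum of independent centred variables with a common law. -/
theorem sum_prod_mul_sum_sq {p : B → ℝ} (hp : p ∈ stdSimplex ℝ B) (g : B → ℝ)
    (hg : ∑ c, p c * g c = 0) :
    ∑ b : ι → B, (∏ k, p (b k)) * (∑ k, g (b k)) ^ 2 =
      Fintype.card ι * ∑ c, p c * g c ^ 2 := by
  have hp' : ∀ _ : ι, p ∈ stdSimplex ℝ B := fun _ => hp
  simp_rw [sq (∑ k, g _), Finset.sum_mul_sum, Finset.mul_sum]
  rw [Finset.sum_comm]
  have h1 : ∀ i : ι, ∑ b : ι → B, ∑ j, (∏ k, p (b k)) * (g (b i) * g (b j)) =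
      ∑ c, p c * g c ^ 2 := by
    intro i
    rw [Finset.sum_comm, Finset.sum_eq_single i]
    · rw [sum_prod_mul_apply hp' i (fun c => g c * g c)]
      simp [sq]
    · intro j _ hj
      rw [sum_prod_mul_apply_mul_apply hp' hj.symm g g, hg, zero_mul]
    · simp
  rw [Finset.sum_congr rfl fun i _ => h1 i]
  simp [Finset.mul_sum]

/-- Chebyshev's inequality for the lower tail of a sum of independent variables with a common law
`p`: the sum rarely falls below its mean by a multiple of the number of terms. -/
theorem sum_prod_mul_lowerTail_le {p : B → ℝ} (hp : p ∈ stdSimplex ℝ B) (f : B → ℝ)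
    {ε : ℝ} (hε : 0 < ε) (hι : 0 < Fintype.card ι) :
    ∑ b : ι → B, (∏ k, p (b k)) *
        (if ∑ k, f (b k) ≤ Fintype.card ι * (∑ c, p c * f c - ε) then 1 else 0) ≤
      (∑ c, p c * (f c - ∑ c', p c' * f c') ^ 2) / ε ^ 2 / Fintype.card ι := by
  set m := ∑ c, p c * f c with hm
  set n : ℝ := (Fintype.card ι : ℝ) with hn
  have hn0 : 0 < n := by rw [hn]; exact_mod_cast hι
  have hg : ∑ c, p c * (f c - m) = 0 := by
    simp_rw [mul_sub, Finset.sum_sub_distrib, ← Finset.sum_mul, hp.2, one_mul, ← hm, sub_self]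
  have hvar := sum_prod_mul_sum_sq (ι := ι) hp (fun c => f c - m) hg
  calc _ ≤ ∑ b : ι → B, (∏ k, p (b k)) * ((∑ k, (f (b k) - m)) ^ 2 / (n * ε) ^ 2) := by
        refine Finset.sum_le_sum fun b _ => mul_le_mul_of_nonneg_left ?_
          (Finset.prod_nonneg fun k _ => hp.1 _)
        split_ifs with h
        · rw [one_le_div (by positivity), Finset.sum_sub_distrib, Finset.sum_const,
            Finset.card_univ, nsmul_eq_mul, ← hn]
          nlinarith [mul_pos hn0 hε]
        · positivity
    _ = _ := by
        simp_rw [← mul_div_assoc]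
        rw [← Finset.sum_div, hvar, ← hn, mul_pow, sq n]
        field_simp

end ProductLaws

/-- Sums over triples of sequences are sums over sequences of triples. -/
theorem sum_sum_sum_eq_sum_arrow {ι A B C : Type*} [Fintype ι] [DecidableEq ι] [Fintype A]
    [Fintype B] [Fintype C] (G : (ι → A) → (ι → B) → (ι → C) → ℝ) :
    ∑ a, ∑ b, ∑ c, G a b c =
      ∑ u : ι → A × B × C, G (fun i => (u i).1) (fun i => (u i).2.1) (fun i => (u i).2.2) := by
  simp_rw [← Fintype.sum_prod_type']
  refine Fintype.sum_equiv
    (((Equiv.refl _).prodCongr (Equiv.arrowProdEquivProdArrow ι _ _).symm).trans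
      (Equiv.arrowProdEquivProdArrow ι _ _).symm) _ _ fun x => rfl

/-- The pointwise form of Gibbs' inequality; the case `p = 0` is the convention `0 log 0 = 0`. -/
theorem mul_log_div_le_sub {p r : ℝ} (hp : 0 ≤ p) (hr : 0 ≤ r) (h : 0 < p → 0 < r) :
    p * Real.log (r / p) ≤ r - p := by
  rcases hp.eq_or_lt with rfl | hp
  · simpa using hr
  · have := Real.log_le_sub_one_of_pos (div_pos (h hp) hp)
    calc p * Real.log (r / p) ≤ p * (r / p - 1) := by gcongr
      _ = r - p := by field_simp

/-! ### Mutual information over a channel with state -/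

namespace StateChannel

theorem sum_jointLaw_output {X Y S : Type*} [Fintype Y] [Fintype S] (N : StateChannel X Y S)
    {P : S → X → ℝ} (s : S) (x : X) :
    ∑ y, N.jointLaw P (s, x, y) = N.stateLaw s * P s x := by
  simp_rw [jointLaw, ← Finset.mul_sum, (N.kernel_mem _).2, mul_one]

variable {X Y S : Type*} [Fintype X] [Fintype Y] [Fintype S]

/-- The conditional law `P(y ∣ s)` of the channel output for an input law `P_{X∣S}`. -/
noncomputable def outLaw (N : StateChannel X Y S) (P : S → X → ℝ) (s : S) (y : Y) : ℝ :=
  ∑ x, P s x * N.kernel (x, s) y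

variable (N : StateChannel X Y S) {P : S → X → ℝ}

theorem outLaw_nonneg (hP : P ∈ condPMF S X) (s : S) (y : Y) : 0 ≤ N.outLaw P s y :=
  Finset.sum_nonneg fun x _ => mul_nonneg ((hP s).1 x) ((N.kernel_mem _).1 y)

theorem sum_outLaw (hP : P ∈ condPMF S X) (s : S) : ∑ y, N.outLaw P s y = 1 := by
  unfold outLaw
  rw [Finset.sum_comm]
  simp_rw [← Finset.mul_sum, (N.kernel_mem _).2, mul_one, (hP s).2]

theorem mul_kernel_le_outLaw (hP : P ∈ condPMF S X) (s : S) (x : X) (y : Y) :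
    P s x * N.kernel (x, s) y ≤ N.outLaw P s y :=
  Finset.single_le_sum (f := fun x => P s x * N.kernel (x, s) y)
    (fun x _ => mul_nonneg ((hP s).1 x) ((N.kernel_mem _).1 y)) (Finset.mem_univ x)

theorem jointLaw_nonneg (hP : P ∈ condPMF S X) (t : S × X × Y) : 0 ≤ N.jointLaw P t :=
  mul_nonneg (mul_nonneg (N.stateLaw_mem.1 _) ((hP _).1 _)) ((N.kernel_mem _).1 _)

theorem sum_jointLaw_input (s : S) (y : Y) :
    ∑ x, N.jointLaw P (s, x, y) = N.stateLaw s * N.outLaw P s y := by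
  simp_rw [jointLaw, outLaw, mul_assoc, ← Finset.mul_sum]

theorem jointLaw_mem (hP : P ∈ condPMF S X) : N.jointLaw P ∈ stdSimplex ℝ (S × X × Y) := by
  refine ⟨N.jointLaw_nonneg hP, ?_⟩
  simp_rw [Fintype.sum_prod_type, sum_jointLaw_output, ← Finset.mul_sum, (hP _).2, mul_one,
    N.stateLaw_mem.2]

theorem pos_of_jointLaw_pos (hP : P ∈ condPMF S X) {s : S} {x : X} {y : Y}
    (h : 0 < N.jointLaw P (s, x, y)) :
    0 < N.stateLaw s ∧ 0 < P s x ∧ 0 < N.kernel (x, s) y ∧ 0 < N.outLaw P s y := by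
  have h0 : N.stateLaw s * P s x * N.kernel (x, s) y ≠ 0 := h.ne'
  have hs := (N.stateLaw_mem.1 s).lt_of_ne' (fun h => h0 (by simp [h]))
  have hx := ((hP s).1 x).lt_of_ne' (fun h => h0 (by simp [h]))
  have hy := ((N.kernel_mem (x, s)).1 y).lt_of_ne' (fun h => h0 (by simp [h]))
  exact ⟨hs, hx, hy, (mul_pos hx hy).trans_le (N.mul_kernel_le_outLaw hP s x y)⟩

/-- `I(X;Y∣S)` is the mean of the information density `log₂ (N(y∣x,s) / P(y∣s))`. -/
theorem condMutualInfo_jointLaw (hP : P ∈ condPMF S X) :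
    condMutualInfo (N.jointLaw P) = ∑ s, ∑ x, ∑ y, N.jointLaw P (s, x, y) *
      Real.logb 2 (N.kernel (x, s) y / N.outLaw P s y) := by
  unfold condMutualInfo
  refine Finset.sum_congr rfl fun s _ => Finset.sum_congr rfl fun x _ =>
    Finset.sum_congr rfl fun y _ => ?_
  simp_rw [sum_jointLaw_output, sum_jointLaw_input, ← Finset.mul_sum, (hP _).2, mul_one]
  rcases (N.jointLaw_nonneg hP (s, x, y)).eq_or_lt with h | h
  · simp [← h]
  · obtain ⟨h1, h2, h3, h4⟩ := N.pos_of_jointLaw_pos hP h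
    congr 2
    simp only [jointLaw]
    field_simp

/-- Replacing the output law by any other family `Q(y∣s)` of probability laws in the information
density increases its mean, as the difference is a relative entropy. -/
theorem condMutualInfo_jointLaw_le (hP : P ∈ condPMF S X) {Q : S → Y → ℝ} (hQ : Q ∈ condPMF S Y)
    (hpos : ∀ s x y, 0 < N.jointLaw P (s, x, y) → 0 < Q s y) :
    condMutualInfo (N.jointLaw P) ≤ ∑ s, ∑ x, ∑ y, N.jointLaw P (s, x, y) *
      Real.logb 2 (N.kernel (x, s) y / Q s y) := by
  rw [condMutualInfo_jointLaw N hP, ← sub_nonpos]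
  simp_rw [← Finset.sum_sub_distrib, ← mul_sub]
  have hterm : ∀ s x y, N.jointLaw P (s, x, y) *
      (Real.logb 2 (N.kernel (x, s) y / N.outLaw P s y) -
        Real.logb 2 (N.kernel (x, s) y / Q s y)) =
      N.jointLaw P (s, x, y) * Real.logb 2 (Q s y / N.outLaw P s y) := by
    intro s x y
    rcases (N.jointLaw_nonneg hP (s, x, y)).eq_or_lt with h | h
    · simp [← h]
    · obtain ⟨h1, h2, h3, h4⟩ := N.pos_of_jointLaw_pos hP h
      have h5 := hpos s x y h
      rw [Real.logb_div h3.ne' h4.ne', Real.logb_div h3.ne' h5.ne', Real.logb_div h5.ne' h4.ne']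
      ring
  simp_rw [hterm]
  have hsum : ∀ s, ∑ x, ∑ y, N.jointLaw P (s, x, y) * Real.logb 2 (Q s y / N.outLaw P s y) =
      (∑ y, (N.stateLaw s * N.outLaw P s y) *
        Real.log ((N.stateLaw s * Q s y) / (N.stateLaw s * N.outLaw P s y))) / Real.log 2 := by
    intro s
    rw [Finset.sum_comm, Finset.sum_div]
    refine Finset.sum_congr rfl fun y _ => ?_
    rw [← Finset.sum_mul, sum_jointLaw_input]
    rcases eq_or_ne (N.stateLaw s) 0 with h | h
    · simp [h]
    · rw [mul_div_mul_left _ _ h, Real.logb, mul_div_assoc]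
  simp_rw [hsum, ← Finset.sum_div]
  refine div_nonpos_of_nonpos_of_nonneg ?_ (Real.log_nonneg (by norm_num))
  calc _ ≤ ∑ s, ∑ y, (N.stateLaw s * Q s y - N.stateLaw s * N.outLaw P s y) := by
        refine Finset.sum_le_sum fun s _ => Finset.sum_le_sum fun y _ =>
          mul_log_div_le_sub (mul_nonneg (N.stateLaw_mem.1 s) (N.outLaw_nonneg hP s y))
            (mul_nonneg (N.stateLaw_mem.1 s) ((hQ s).1 y)) fun h => ?_
        rw [← sum_jointLaw_input] at h
        obtain ⟨x, _, hx⟩ := Finset.exists_ne_zero_of_sum_ne_zero h.ne'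
        have hx := (N.jointLaw_nonneg hP (s, x, y)).lt_of_ne' hx
        exact mul_pos (N.pos_of_jointLaw_pos hP hx).1 (hpos s x y hx)
    _ = 0 := by
        simp_rw [Finset.sum_sub_distrib, ← Finset.mul_sum, (hQ _).2, N.sum_outLaw hP, sub_self]

/-- The conditional mutual information is `H(Y∣S) - H(Y∣X,S)`. -/
theorem condMutualInfo_jointLaw_eq_entropy (hP : P ∈ condPMF S X) :
    condMutualInfo (N.jointLaw P) = (∑ s, ∑ y, N.stateLaw s * Real.negMulLog (N.outLaw P s y) -
      ∑ s, ∑ x, ∑ y, N.stateLaw s * P s x * Real.negMulLog (N.kernel (x, s) y)) / Real.log 2 := by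
  rw [condMutualInfo_jointLaw N hP, ← Finset.sum_sub_distrib, Finset.sum_div]
  refine Finset.sum_congr rfl fun s _ => ?_
  have h1 : ∑ y, N.stateLaw s * Real.negMulLog (N.outLaw P s y) =
      ∑ x, ∑ y, -(N.jointLaw P (s, x, y) * Real.log (N.outLaw P s y)) := by
    rw [Finset.sum_comm]
    refine Finset.sum_congr rfl fun y _ => ?_
    rw [Finset.sum_neg_distrib, ← Finset.sum_mul, sum_jointLaw_input, Real.negMulLog]
    ring
  rw [h1, ← Finset.sum_sub_distrib, Finset.sum_div]
  refine Finset.sum_congr rfl fun x _ => ?_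
  rw [← Finset.sum_sub_distrib, Finset.sum_div]
  refine Finset.sum_congr rfl fun y _ => ?_
  rcases (N.jointLaw_nonneg hP (s, x, y)).eq_or_lt with h | h
  · have h' : N.stateLaw s * P s x * N.kernel (x, s) y = 0 := h.symm
    rw [← h, Real.negMulLog, show ∀ L : ℝ, N.stateLaw s * P s x * (-N.kernel (x, s) y * L) =
      -(N.stateLaw s * P s x * N.kernel (x, s) y) * L by intro L; ring, h']
    simp
  · obtain ⟨h1, h2, h3, h4⟩ := N.pos_of_jointLaw_pos hP h
    rw [Real.logb, Real.log_div h3.ne' h4.ne', Real.negMulLog, jointLaw]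
    ring

theorem exists_isGreatest_condMutualInfo [Nonempty X] :
    ∃ C, IsGreatest ((fun P : S → X → ℝ => condMutualInfo (N.jointLaw P)) '' condPMF S X) C := by
  classical
  have hcompact : IsCompact (condPMF S X) := by
    have : condPMF S X = Set.univ.pi fun _ => stdSimplex ℝ X := by
      ext W; simp [condPMF]
    rw [this]
    exact isCompact_univ_pi fun _ => isCompact_stdSimplex ℝ X
  refine (hcompact.image_of_continuousOn ?_).exists_isGreatest ?_
  · refine ContinuousOn.congr (Continuous.continuousOn ?_)
      fun P hP => N.condMutualInfo_jointLaw_eq_entropy hP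
    have hout : ∀ s y, Continuous fun P : S → X → ℝ => N.outLaw P s y := by
      intro s y
      unfold outLaw
      fun_prop
    have := Real.continuous_negMulLog
    fun_prop
  · exact Set.Nonempty.image _
      ⟨fun _ => Pi.single (Classical.arbitrary X) 1, fun _ => single_mem_stdSimplex ℝ _⟩

/-- Over `N̄` the mutual information `I(X;Y,S_R∣S)` is `I(X;Y∣S)`, as `S_R` is a function of `S`. -/
theorem condMutualInfo_bar_jointLaw [DecidableEq S] (hP : P ∈ condPMF S X) :
    condMutualInfo (N.bar.jointLaw P) = condMutualInfo (N.jointLaw P) := by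
  rw [condMutualInfo_jointLaw _ hP, condMutualInfo_jointLaw _ hP]
  refine Finset.sum_congr rfl fun s _ => Finset.sum_congr rfl fun x _ => ?_
  rw [Fintype.sum_prod_type]
  refine Finset.sum_congr rfl fun y _ => ?_
  rw [Finset.sum_eq_single s]
  · simp [jointLaw, bar, outLaw]
  · intro s' _ hs'
    simp [jointLaw, bar, hs']
  · simp

end StateChannel

/-! ### Single-letter upper bound for product channels -/

namespace StateChannel

section SingleLetter

variable {X Y S : Type*} [Fintype X] [Fintype Y] [Fintype S] [DecidableEq X] [DecidableEq S]
  (N : StateChannel X Y S) {n : ℕ} (P : (Fin n → S) → (Fin n → X) → ℝ)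

/-- The joint law of the state and the input of the `i`-th of `n` uses of the channel, for the
input law `P` of the whole sequence. -/
noncomputable def letterLaw (i : Fin n) (v : S × X) : ℝ :=
  ∑ u : (Fin n → S) × (Fin n → X),
    if (u.1 i, u.2 i) = v then (N.pow n).stateLaw u.1 * P u.1 u.2 else 0

/-- The conditional law of the `i`-th input given the `i`-th state. On states of probability zero it
is uniform, an arbitrary choice. -/
noncomputable def letterInput (i : Fin n) (s : S) (x : X) : ℝ :=
  if N.stateLaw s = 0 then 1 / Fintype.card X else N.letterLaw P i (s, x) / N.stateLaw s

theorem sum_letterLaw_mul (i : Fin n) (G : S × X → ℝ) :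
    ∑ v, N.letterLaw P i v * G v = ∑ σ, ∑ ξ, (N.pow n).stateLaw σ * P σ ξ * G (σ i, ξ i) := by
  simp_rw [letterLaw, Finset.sum_mul]
  rw [Finset.sum_comm, Fintype.sum_prod_type]
  simp [ite_mul]

variable {P}

theorem letterLaw_nonneg (hP : P ∈ condPMF (Fin n → S) (Fin n → X)) (i : Fin n) (v : S × X) :
    0 ≤ N.letterLaw P i v :=
  Finset.sum_nonneg fun u _ => by
    split_ifs
    · exact mul_nonneg ((N.pow n).stateLaw_mem.1 _) ((hP _).1 _)
    · exact le_rfl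

theorem le_letterLaw (hP : P ∈ condPMF (Fin n → S) (Fin n → X)) (i : Fin n) (σ : Fin n → S)
    (ξ : Fin n → X) : (N.pow n).stateLaw σ * P σ ξ ≤ N.letterLaw P i (σ i, ξ i) := by
  have := Finset.single_le_sum (f := fun u : (Fin n → S) × (Fin n → X) =>
    if (u.1 i, u.2 i) = (σ i, ξ i) then (N.pow n).stateLaw u.1 * P u.1 u.2 else 0)
    (fun u _ => by
      split_ifs
      · exact mul_nonneg ((N.pow n).stateLaw_mem.1 _) ((hP _).1 _)
      · exact le_rfl) (Finset.mem_univ (σ, ξ))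
  rwa [if_pos rfl] at this

theorem sum_letterLaw (hP : P ∈ condPMF (Fin n → S) (Fin n → X)) (i : Fin n) (s : S) :
    ∑ x, N.letterLaw P i (s, x) = N.stateLaw s := by
  have h := N.sum_letterLaw_mul P i (fun v => if v.1 = s then 1 else 0)
  have h' : ∀ σ, ∑ ξ, (N.pow n).stateLaw σ * P σ ξ * (if σ i = s then (1 : ℝ) else 0) =
      (N.pow n).stateLaw σ * (if σ i = s then (1 : ℝ) else 0) := fun σ => by
    rw [← Finset.sum_mul, ← Finset.mul_sum, (hP σ).2, mul_one]
  simp only [h'] at h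
  rw [show (N.pow n).stateLaw = fun σ => ∏ k, N.stateLaw (σ k) from rfl,
    sum_prod_mul_apply (p := fun _ : Fin n => N.stateLaw) (fun _ => N.stateLaw_mem) i
      (fun c => if c = s then (1 : ℝ) else 0), Fintype.sum_prod_type_right] at h
  simpa using h

theorem stateLaw_mul_letterInput (hP : P ∈ condPMF (Fin n → S) (Fin n → X)) (i : Fin n) (s : S)
    (x : X) : N.stateLaw s * N.letterInput P i s x = N.letterLaw P i (s, x) := by
  unfold letterInput
  split_ifs with h
  · have h1 : N.letterLaw P i (s, x) ≤ ∑ x, N.letterLaw P i (s, x) :=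
      Finset.single_le_sum (f := fun x => N.letterLaw P i (s, x))
        (fun x _ => N.letterLaw_nonneg hP i (s, x)) (Finset.mem_univ x)
    rw [N.sum_letterLaw hP, h] at h1
    rw [h, zero_mul, le_antisymm h1 (N.letterLaw_nonneg hP i _)]
  · field_simp

theorem letterInput_mem [Nonempty X] (hP : P ∈ condPMF (Fin n → S) (Fin n → X)) (i : Fin n) :
    N.letterInput P i ∈ condPMF S X := by
  intro s
  unfold letterInput
  split_ifs with h
  · exact ⟨fun x => by positivity, by simp⟩
  · exact ⟨fun x => div_nonneg (N.letterLaw_nonneg hP i _) (N.stateLaw_mem.1 s), by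
      rw [← Finset.sum_div, N.sum_letterLaw hP, div_self h]⟩

/-- Over a product channel, the mean of a function of the `i`-th letters is a mean over one use of
the channel with the `i`-th marginal input law. -/
theorem sum_pow_jointLaw_mul (hP : P ∈ condPMF (Fin n → S) (Fin n → X)) (i : Fin n)
    (F : S → X → Y → ℝ) :
    ∑ σ, ∑ ξ, ∑ y, (N.pow n).jointLaw P (σ, ξ, y) * F (σ i) (ξ i) (y i) =
      ∑ s, ∑ x, ∑ y, N.jointLaw (N.letterInput P i) (s, x, y) * F s x y := by
  have hL : ∀ σ ξ, ∑ y, (N.pow n).jointLaw P (σ, ξ, y) * F (σ i) (ξ i) (y i) =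
      (N.pow n).stateLaw σ * P σ ξ * ∑ y, N.kernel (ξ i, σ i) y * F (σ i) (ξ i) y := by
    intro σ ξ
    rw [← sum_prod_mul_apply (p := fun k => N.kernel (ξ k, σ k)) (fun k => N.kernel_mem _) i
      (F (σ i) (ξ i)), Finset.mul_sum]
    exact Finset.sum_congr rfl fun y _ => by simp only [jointLaw, pow]; ring
  simp_rw [hL]
  rw [← N.sum_letterLaw_mul P i (fun v => ∑ y, N.kernel (v.2, v.1) y * F v.1 v.2 y),
    Fintype.sum_prod_type]
  refine Finset.sum_congr rfl fun s _ => Finset.sum_congr rfl fun x _ => ?_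
  rw [← N.stateLaw_mul_letterInput hP, Finset.mul_sum]
  exact Finset.sum_congr rfl fun y _ => by simp only [jointLaw]; ring

theorem pos_of_pow_jointLaw_pos [Nonempty X] (hP : P ∈ condPMF (Fin n → S) (Fin n → X))
    {σ : Fin n → S} {ξ : Fin n → X} {y : Fin n → Y} (h : 0 < (N.pow n).jointLaw P (σ, ξ, y))
    (i : Fin n) :
    0 < N.kernel (ξ i, σ i) (y i) ∧ 0 < N.outLaw (N.letterInput P i) (σ i) (y i) := by
  obtain ⟨h1, h2, h3, -⟩ := (N.pow n).pos_of_jointLaw_pos hP h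
  have h3' : ∏ i, N.kernel (ξ i, σ i) (y i) ≠ 0 := h3.ne'
  have hk : 0 < N.kernel (ξ i, σ i) (y i) :=
    ((N.kernel_mem _).1 _).lt_of_ne' (Finset.prod_ne_zero_iff.1 h3' i (Finset.mem_univ i))
  have hl := (mul_pos h1 h2).trans_le (N.le_letterLaw hP i σ ξ)
  have : 0 < N.jointLaw (N.letterInput P i) (σ i, ξ i, y i) := by
    simp only [jointLaw]
    rw [N.stateLaw_mul_letterInput hP]
    exact mul_pos hl hk
  exact ⟨hk, (N.pos_of_jointLaw_pos (N.letterInput_mem hP i) this).2.2.2⟩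

/-- Mutual information over a product channel is at most the sum of the mutual informations of its
letters: compare the output law of the block with the product of the output laws of the letters. -/
theorem condMutualInfo_pow_le_sum [Nonempty X] (hP : P ∈ condPMF (Fin n → S) (Fin n → X)) :
    condMutualInfo ((N.pow n).jointLaw P) ≤
      ∑ i, condMutualInfo (N.jointLaw (N.letterInput P i)) := by
  have hin := N.letterInput_mem hP
  have hpos := fun σ ξ y h i => N.pos_of_pow_jointLaw_pos hP (σ := σ) (ξ := ξ) (y := y) h i
  obtain ⟨F, hF⟩ : ∃ F : Fin n → S → X → Y → ℝ, ∀ i s x y, F i s x y =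
      Real.logb 2 (N.kernel (x, s) y / N.outLaw (N.letterInput P i) s y) :=
    ⟨_, fun _ _ _ _ => rfl⟩
  have h1 := condMutualInfo_jointLaw_le (N.pow n) hP
    (Q := fun σ y => ∏ i, N.outLaw (N.letterInput P i) (σ i) (y i))
    (fun σ => prod_mem_stdSimplex (fun i => N.outLaw (N.letterInput P i) (σ i)) fun i =>
      ⟨N.outLaw_nonneg (hin i) _, N.sum_outLaw (hin i) _⟩)
    fun σ ξ y h => Finset.prod_pos fun i _ => (hpos σ ξ y h i).2
  have h2 : ∀ σ ξ y, (N.pow n).jointLaw P (σ, ξ, y) * Real.logb 2 ((N.pow n).kernel (ξ, σ) y /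
      ∏ i, N.outLaw (N.letterInput P i) (σ i) (y i)) =
      ∑ i, (N.pow n).jointLaw P (σ, ξ, y) * F i (σ i) (ξ i) (y i) := by
    intro σ ξ y
    rcases ((N.pow n).jointLaw_nonneg hP (σ, ξ, y)).eq_or_lt with h | h
    · simp only [← h, zero_mul, Finset.sum_const_zero]
    · rw [← Finset.mul_sum, show (N.pow n).kernel (ξ, σ) y = ∏ i, N.kernel (ξ i, σ i) (y i)
        from rfl, ← Finset.prod_div_distrib, Real.logb_prod _ _
          fun i _ => (div_pos (hpos σ ξ y h i).1 (hpos σ ξ y h i).2).ne']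
      simp only [hF]
  simp only [h2] at h1
  refine h1.trans_eq ?_
  have h3 : ∀ i, condMutualInfo (N.jointLaw (N.letterInput P i)) =
      ∑ σ, ∑ ξ, ∑ y, (N.pow n).jointLaw P (σ, ξ, y) * F i (σ i) (ξ i) (y i) := fun i => by
    rw [N.sum_pow_jointLaw_mul hP i (F i), condMutualInfo_jointLaw _ (hin i)]
    simp only [hF]
  simp only [h3]
  rw [Finset.sum_comm (s := (Finset.univ : Finset (Fin n)))]
  refine Finset.sum_congr rfl fun σ _ => ?_
  rw [Finset.sum_comm (s := (Finset.univ : Finset (Fin n)))]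
  refine Finset.sum_congr rfl fun ξ _ => ?_
  rw [Finset.sum_comm (s := (Finset.univ : Finset (Fin n)))]

end SingleLetter

theorem condMutualInfo_pow_le {X Y S : Type*} [Fintype X] [Nonempty X] [Fintype Y] [Fintype S]
    (N : StateChannel X Y S) {C : ℝ}
    (hC : ∀ P ∈ condPMF S X, condMutualInfo (N.jointLaw P) ≤ C) {n : ℕ}
    {P : (Fin n → S) → (Fin n → X) → ℝ} (hP : P ∈ condPMF (Fin n → S) (Fin n → X)) :
    condMutualInfo ((N.pow n).jointLaw P) ≤ n * C := by
  classical
  refine (N.condMutualInfo_pow_le_sum hP).trans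
    ((Finset.sum_le_sum fun i _ => hC _ (N.letterInput_mem hP i)).trans_eq ?_)
  simp

end StateChannel

/-! ### One-shot converse for non-signaling assisted schemes -/

namespace Scheme

variable {X Y S : Type*} {M : ℕ}

/-- The probability that the scheme emits the input `x` and decodes correctly, given the state `s`
and the output `y`, for a uniformly distributed message. -/
noncomputable def successKernel (Z : Scheme X Y S M) (s : S) (x : X) (y : Y) : ℝ :=
  1 / M * ∑ w, Z ((w, s), y) (x, w)

/-- The probability that the scheme emits the input `x`, given the state `s` and the output `y`, for
a uniformly distributed message. For non-signaling schemes it does not depend on `y`. -/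
noncomputable def inputKernel (Z : Scheme X Y S M) (s : S) (x : X) (y : Y) : ℝ :=
  1 / M * ∑ w, ∑ w', Z ((w, s), y) (x, w')

variable [Fintype X] {Z : Scheme X Y S M}

theorem successKernel_nonneg (hZ : Z ∈ nsSchemes X Y S M) (s : S) (x : X) (y : Y) :
    0 ≤ Z.successKernel s x y :=
  mul_nonneg (by positivity) (Finset.sum_nonneg fun w _ => (hZ.1 _).1 _)

theorem successKernel_le_inputKernel (hZ : Z ∈ nsSchemes X Y S M) (s : S) (x : X) (y : Y) :
    Z.successKernel s x y ≤ Z.inputKernel s x y :=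
  mul_le_mul_of_nonneg_left (Finset.sum_le_sum fun w _ =>
    Finset.single_le_sum (f := fun w' => Z ((w, s), y) (x, w')) (fun _ _ => (hZ.1 _).1 _)
      (Finset.mem_univ w)) (by positivity)

theorem inputKernel_congr (hZ : Z ∈ nsSchemes X Y S M) (s : S) (x : X) (y y' : Y) :
    Z.inputKernel s x y = Z.inputKernel s x y' := by
  unfold inputKernel
  simp_rw [hZ.2.1 _ y y' x]

theorem sum_inputKernel (hM : 0 < M) (hZ : Z ∈ nsSchemes X Y S M) (s : S) (y : Y) :
    ∑ x, Z.inputKernel s x y = 1 := by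
  unfold inputKernel
  rw [← Finset.mul_sum, Finset.sum_comm]
  have h : ∀ w, ∑ x, ∑ w', Z ((w, s), y) (x, w') = 1 := fun w => by
    rw [← (hZ.1 ((w, s), y)).2, Fintype.sum_prod_type]
  have : (M : ℝ) ≠ 0 := by positivity
  simp [h, this]

/-- A decoder that is not signaled the message guesses it with probability `1 / M`. -/
theorem sum_successKernel (hM : 0 < M) (hZ : Z ∈ nsSchemes X Y S M) (s : S) (y : Y) :
    ∑ x, Z.successKernel s x y = 1 / M := by
  unfold successKernel
  rw [← Finset.mul_sum, Finset.sum_comm]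
  simp_rw [fun w => hZ.2.2 (w, s) (⟨0, hM⟩, s) y w]
  rw [← Fintype.sum_prod_type_right' (f := fun x w => Z ((⟨0, hM⟩, s), y) (x, w)),
    (hZ.1 _).2, mul_one]

end Scheme

namespace StateChannel

theorem inducedLaw_apply {X Y S : Type*} [Fintype Y] [Fintype S] (N : StateChannel X Y S) {M : ℕ}
    (Z : Scheme X Y S M) (s : S) (x : X) (y : Y) :
    N.inducedLaw Z (s, x, y) = N.stateLaw s * N.kernel (x, s) y * Z.inputKernel s x y := by
  unfold inducedLaw Scheme.inputKernel
  simp_rw [Finset.mul_sum]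
  exact Finset.sum_congr rfl fun w _ => Finset.sum_congr rfl fun w' _ => by ring

theorem nonempty_state {X Y S : Type*} [Fintype Y] [Fintype S] (N : StateChannel X Y S) :
     Nonempty S := by
  by_contra h
  rw [not_nonempty_iff] at h
  simpa using N.stateLaw_mem.2

theorem nonempty_output {X Y S : Type*} [Fintype Y] [Fintype S] [Nonempty X]
    (N : StateChannel X Y S) : Nonempty Y := by
  obtain ⟨s⟩ := N.nonempty_state
  by_contra h
  rw [not_nonempty_iff] at h
  simpa using (N.kernel_mem (Classical.arbitrary X, s)).2

variable {X Y S : Type*} [Fintype X] [Fintype Y] [Fintype S] (N : StateChannel X Y S) {M : ℕ}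

theorem successProb_eq (Z : Scheme X Y S M) :
    N.successProb Z = ∑ s, ∑ x, ∑ y, N.stateLaw s * N.kernel (x, s) y * Z.successKernel s x y := by
  unfold successProb Scheme.successKernel
  simp_rw [Finset.mul_sum]
  rw [Finset.sum_comm]
  refine Finset.sum_congr rfl fun s _ => ?_
  rw [Finset.sum_comm]
  refine Finset.sum_congr rfl fun x _ => ?_
  rw [Finset.sum_comm]
  exact Finset.sum_congr rfl fun y _ => Finset.sum_congr rfl fun w _ => by ring

/-- The input law that a non-signaling scheme induces. -/
theorem exists_inputLaw [Nonempty X] (hM : 0 < M) {Z : Scheme X Y S M}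
    (hZ : Z ∈ nsSchemes X Y S M) :
    ∃ P ∈ condPMF S X, (∀ s x y, Z.inputKernel s x y = P s x) ∧
      N.inducedLaw Z = N.jointLaw P := by
  obtain ⟨y₀⟩ := N.nonempty_output
  refine ⟨fun s x => Z.inputKernel s x y₀, fun s => ⟨fun x =>
    (Scheme.successKernel_nonneg hZ s x y₀).trans (Scheme.successKernel_le_inputKernel hZ s x y₀),
    Scheme.sum_inputKernel hM hZ s y₀⟩, fun s x y => Scheme.inputKernel_congr hZ s x y y₀, ?_⟩
  funext t
  obtain ⟨s, x, y⟩ := t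
  rw [inducedLaw_apply, Scheme.inputKernel_congr hZ s x y y₀, jointLaw]
  ring

/-- The one-shot converse. Running the scheme with an output that is independent of the input given
the state makes it succeed with probability `1 / M` only, so the relative entropy between the two
resulting laws, which is `I(X;Y∣S)`, is at least the binary one between `η` and `1 / M`. -/
theorem successProb_mul_logb_le [Nonempty X] (hM : 0 < M) {Z : Scheme X Y S M}
    (hZ : Z ∈ nsSchemes X Y S M) :
    N.successProb Z * Real.logb 2 M - Real.binEntropy (N.successProb Z) / Real.log 2 ≤
      condMutualInfo (N.inducedLaw Z) := by
  obtain ⟨P, hP, hPZ, hlaw⟩ := N.exists_inputLaw hM hZ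
  rw [hlaw, condMutualInfo_jointLaw N hP]
  set η := N.successProb Z with hη
  set r := Z.successKernel with hr
  have hM' : (0 : ℝ) < M := by exact_mod_cast hM
  have hr0 : ∀ s x y, 0 ≤ r s x y := Scheme.successKernel_nonneg hZ
  have hrP : ∀ s x y, r s x y ≤ P s x := fun s x y =>
    (Scheme.successKernel_le_inputKernel hZ s x y).trans_eq (hPZ s x y)
  have hs0 := N.stateLaw_mem.1
  have hk0 : ∀ s x y, 0 ≤ N.kernel (x, s) y := fun s x y => (N.kernel_mem _).1 y
  have ho0 := N.outLaw_nonneg hP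
  -- The law of `(S, X, Y)` restricted to success and to failure, over the channel (`J`) and with an
  -- output drawn from `P(y∣s)` independently of the input (`R`).
  set J₁ : S → X → Y → ℝ := fun s x y => N.stateLaw s * N.kernel (x, s) y * r s x y with hJ₁
  set J₂ : S → X → Y → ℝ := fun s x y => N.stateLaw s * N.kernel (x, s) y * (P s x - r s x y)
    with hJ₂
  set R₁ : S → X → Y → ℝ := fun s x y => N.stateLaw s * N.outLaw P s y * r s x y with hR₁
  set R₂ : S → X → Y → ℝ := fun s x y => N.stateLaw s * N.outLaw P s y * (P s x - r s x y)
    with hR₂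
  have hJ₁0 : ∀ s x y, 0 ≤ J₁ s x y := fun s x y =>
    mul_nonneg (mul_nonneg (hs0 s) (hk0 s x y)) (hr0 s x y)
  have hJ₂0 : ∀ s x y, 0 ≤ J₂ s x y := fun s x y =>
    mul_nonneg (mul_nonneg (hs0 s) (hk0 s x y)) (sub_nonneg.2 (hrP s x y))
  have hR₁0 : ∀ s x y, 0 ≤ R₁ s x y := fun s x y =>
    mul_nonneg (mul_nonneg (hs0 s) (ho0 s y)) (hr0 s x y)
  have hR₂0 : ∀ s x y, 0 ≤ R₂ s x y := fun s x y =>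
    mul_nonneg (mul_nonneg (hs0 s) (ho0 s y)) (sub_nonneg.2 (hrP s x y))
  have hJ : ∀ s x y, J₁ s x y + J₂ s x y = N.jointLaw P (s, x, y) := fun s x y => by
    simp only [hJ₁, hJ₂, jointLaw]; ring
  have sJ₁ : ∑ s, ∑ x, ∑ y, J₁ s x y = η := (N.successProb_eq Z).symm
  have sJ : ∑ s, ∑ x, ∑ y, N.jointLaw P (s, x, y) = 1 := by
    have := (N.jointLaw_mem hP).2
    simpa only [Fintype.sum_prod_type] using this
  have sJ₂ : ∑ s, ∑ x, ∑ y, J₂ s x y = 1 - η := by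
    rw [← sJ, ← sJ₁]
    simp_rw [← hJ, Finset.sum_add_distrib]
    ring
  have sR₁ : ∑ s, ∑ x, ∑ y, R₁ s x y = 1 / M := by
    have : ∀ s, ∑ x, ∑ y, R₁ s x y = N.stateLaw s * (1 / M) := fun s => by
      rw [Finset.sum_comm]
      simp_rw [hR₁, ← Finset.mul_sum, hr, Scheme.sum_successKernel hM hZ, ← Finset.sum_mul,
        ← Finset.mul_sum, N.sum_outLaw hP, mul_one]
    simp_rw [this, ← Finset.sum_mul, N.stateLaw_mem.2, one_mul]
  have sR₂ : ∑ s, ∑ x, ∑ y, R₂ s x y = 1 - 1 / M := by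
    rw [← sR₁, eq_sub_iff_add_eq]
    simp_rw [← Finset.sum_add_distrib, hR₁, hR₂, ← mul_add, sub_add_cancel]
    have : ∀ s, ∑ x, ∑ y, N.stateLaw s * N.outLaw P s y * P s x = N.stateLaw s := fun s => by
      rw [Finset.sum_comm]
      simp_rw [← Finset.mul_sum, (hP _).2, mul_one, ← Finset.mul_sum, N.sum_outLaw hP, mul_one]
    simp_rw [this, N.stateLaw_mem.2]
  have hη0 : 0 ≤ η := sJ₁ ▸ Finset.sum_nonneg fun s _ => Finset.sum_nonneg fun x _ =>
    Finset.sum_nonneg fun y _ => hJ₁0 s x y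
  have hη1 : 0 ≤ 1 - η := sJ₂ ▸ Finset.sum_nonneg fun s _ => Finset.sum_nonneg fun x _ =>
    Finset.sum_nonneg fun y _ => hJ₂0 s x y
  -- A triple of positive mass keeps a nonnegative sum positive.
  have hpos : ∀ J : S → X → Y → ℝ, (∀ s x y, 0 ≤ J s x y) → ∀ s x y, 0 < J s x y →
      0 < ∑ s, ∑ x, ∑ y, J s x y := fun J h0 s x y h =>
    h.trans_le <| (Finset.single_le_sum (fun y _ => h0 s x y) (Finset.mem_univ y)).trans <|
      (Finset.single_le_sum (f := fun x => ∑ y, J s x y)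
        (fun x _ => Finset.sum_nonneg fun y _ => h0 s x y) (Finset.mem_univ x)).trans <|
      Finset.single_le_sum (f := fun s => ∑ x, ∑ y, J s x y)
        (fun s _ => Finset.sum_nonneg fun x _ => Finset.sum_nonneg fun y _ => h0 s x y)
        (Finset.mem_univ s)
  have term : ∀ (q : ℝ) (s x y), 0 ≤ q → ∀ c : ℝ, 0 ≤ c → q ≤ P s x →
      (0 < N.stateLaw s * N.kernel (x, s) y * q → 0 < c) →
      N.stateLaw s * N.kernel (x, s) y * q *
          (Real.log c - Real.log (N.kernel (x, s) y / N.outLaw P s y)) ≤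
        N.stateLaw s * N.outLaw P s y * q * c - N.stateLaw s * N.kernel (x, s) y * q := by
    intro q s x y hq c hc hqP hcpos
    have hJ0 : 0 ≤ N.stateLaw s * N.kernel (x, s) y * q :=
      mul_nonneg (mul_nonneg (hs0 s) (hk0 s x y)) hq
    rcases hJ0.eq_or_lt with h | h
    · rw [← h, zero_mul, sub_zero]
      exact mul_nonneg (mul_nonneg (mul_nonneg (hs0 s) (ho0 s y)) hq) hc
    · have hc' := hcpos h
      have hsk := pos_of_mul_pos_left h hq
      have hq' : 0 < q := pos_of_mul_pos_right h (mul_nonneg (hs0 s) (hk0 s x y))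
      have hs : 0 < N.stateLaw s := pos_of_mul_pos_left hsk (hk0 s x y)
      have hk : 0 < N.kernel (x, s) y := pos_of_mul_pos_right hsk (hs0 s)
      have ho : 0 < N.outLaw P s y := (mul_pos (hq'.trans_le hqP) hk).trans_le
        (N.mul_kernel_le_outLaw hP s x y)
      have := mul_log_div_le_sub h.le (r := N.stateLaw s * N.outLaw P s y * q * c)
        (by positivity) (fun _ => by positivity)
      rwa [show N.stateLaw s * N.outLaw P s y * q * c / (N.stateLaw s * N.kernel (x, s) y * q) =
        c / (N.kernel (x, s) y / N.outLaw P s y) by field_simp,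
        Real.log_div hc'.ne' (div_pos hk ho).ne'] at this
  -- Weight success by `η M` and failure by `1 - η`, which keeps the second law subnormalized.
  have main : ∑ s, ∑ x, ∑ y, (J₁ s x y * Real.log (η * M) + J₂ s x y * Real.log (1 - η) -
      N.jointLaw P (s, x, y) * Real.log (N.kernel (x, s) y / N.outLaw P s y)) ≤
      ∑ s, ∑ x, ∑ y, (R₁ s x y * (η * M) + R₂ s x y * (1 - η) - N.jointLaw P (s, x, y)) := by
    refine Finset.sum_le_sum fun s _ => Finset.sum_le_sum fun x _ => Finset.sum_le_sum fun y _ => ?_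
    have h1 := term (r s x y) s x y (hr0 s x y) (η * M) (by positivity) (hrP s x y)
      (fun h => mul_pos (sJ₁ ▸ hpos J₁ hJ₁0 s x y h) hM')
    have h2 := term (P s x - r s x y) s x y (sub_nonneg.2 (hrP s x y)) (1 - η) hη1
      (sub_le_self _ (hr0 s x y)) (fun h => sJ₂ ▸ hpos J₂ hJ₂0 s x y h)
    have h3 := hJ s x y
    simp only [hJ₁, hJ₂, hR₁, hR₂] at h3 ⊢
    rw [← h3]
    linarith
  simp_rw [Finset.sum_sub_distrib, Finset.sum_add_distrib, ← Finset.sum_mul, sJ₁, sJ₂, sR₁, sR₂,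
    sJ] at main
  have hlog2 : 0 < Real.log 2 := Real.log_pos (by norm_num)
  have hlogη : η * Real.log (η * M) = η * Real.log M + η * Real.log η := by
    rcases hη0.eq_or_lt with h | h
    · simp [← h]
    · rw [Real.log_mul h.ne' hM'.ne']; ring
  have hbin : Real.binEntropy η = -(η * Real.log η) - (1 - η) * Real.log (1 - η) := by
    rw [Real.binEntropy, Real.log_inv, Real.log_inv]; ring
  simp_rw [Real.logb, ← mul_div_assoc, ← Finset.sum_div]
  rw [← sub_div, div_le_div_iff_of_pos_right hlog2, hbin]
  have hR : 1 / (M : ℝ) * (η * M) + (1 - 1 / M) * (1 - η) ≤ 1 := by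
    have : 1 / (M : ℝ) * (η * M) = η := by field_simp
    rw [this]
    nlinarith [mul_nonneg (one_div_pos.2 hM').le hη1]
  linarith

/-- A sequence of non-signaling schemes cannot beat the single-letter mutual information. -/
theorem nsCapacity_le [Nonempty X] {C : ℝ}
    (hC : ∀ P ∈ condPMF S X, condMutualInfo (N.jointLaw P) ≤ C) : N.nsCapacity ≤ C := by
  refine sSup_le ?_
  rintro _ ⟨R, ⟨-, M, Z, L, hM, hZ, hη, hL, hRL⟩, rfl⟩
  refine EReal.coe_le_coe_iff.2 (hRL.trans ?_)
  have hlim : Tendsto (fun n : ℕ => (N.pow n).successProb (Z n) * (Real.logb 2 (M n) / n) -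
      Real.binEntropy ((N.pow n).successProb (Z n)) / Real.log 2 / n) atTop
      (𝓝 (1 * L - 0)) := by
    refine (hη.mul hL).sub (Tendsto.div_atTop (a := Real.binEntropy 1 / Real.log 2) ?_
      tendsto_natCast_atTop_atTop)
    exact ((Real.binEntropy_continuous.tendsto 1).comp hη).div_const _
  rw [one_mul, sub_zero] at hlim
  refine le_of_tendsto hlim ?_
  filter_upwards [eventually_gt_atTop 0] with n hn
  have hn' : (0 : ℝ) < n := by exact_mod_cast hn
  obtain ⟨P, hP, -, hlaw⟩ := (N.pow n).exists_inputLaw (hM n) (hZ n)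
  have h := (N.pow n).successProb_mul_logb_le (hM n) (hZ n)
  rw [hlaw] at h
  have h' := h.trans (N.condMutualInfo_pow_le hC hP)
  rw [← mul_div_assoc, ← sub_div, div_le_iff₀ hn', mul_comm C]
  exact h'

end StateChannel

/-! ### The decoder does not need the state when non-signaling assistance is available -/

theorem classicalSchemes_subset_nsSchemes (X Y S : Type*) [Fintype X] (M : ℕ) :
    classicalSchemes X Y S M ⊆ nsSchemes X Y S M := by
  rintro Z ⟨Q, _, PQ, E, D, hQ, hE, hD, hZ⟩
  have h1 : ∀ w s y x, ∑ w', Z ((w, s), y) (x, w') = ∑ q, PQ q * E (w, s, q) x := by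
    intro w s y x
    simp_rw [hZ]
    rw [Finset.sum_comm]
    simp_rw [← Finset.mul_sum, (hD _).2, mul_one]
  have h2 : ∀ w s y w', ∑ x, Z ((w, s), y) (x, w') = ∑ q, PQ q * D (y, q) w' := by
    intro w s y w'
    simp_rw [hZ]
    rw [Finset.sum_comm]
    simp_rw [← Finset.sum_mul, ← Finset.mul_sum, (hE _).2, mul_one]
  refine ⟨fun ⟨⟨w, s⟩, y⟩ => ⟨fun ⟨x, w'⟩ => ?_, ?_⟩, fun ⟨w, s⟩ y y' x => ?_,
    fun ⟨w, s⟩ ⟨w₁, s₁⟩ y w' => ?_⟩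
  · rw [hZ]
    exact Finset.sum_nonneg fun q _ =>
      mul_nonneg (mul_nonneg (hQ.1 q) ((hE _).1 x)) ((hD _).1 w')
  · rw [Fintype.sum_prod_type]
    simp_rw [h1]
    rw [Finset.sum_comm]
    simp_rw [← Finset.mul_sum, (hE _).2, mul_one, hQ.2]
  · rw [h1, h1]
  · rw [h2, h2]

/-- Scheme for a decoder that does not see the state, made from a scheme for a decoder that does:
`ι s y` is what the latter decoder observes when the state is `s` and the output is `y`. The scheme
is symmetric in the messages: given `x`, `s` and `y`, it decodes correctly with the probability with
which the given scheme does, and errs uniformly. -/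
noncomputable def Scheme.hideState {X Y Y' S : Type*} {M : ℕ} (Z : Scheme X Y' S M)
    (ι : S → Y → Y') : Scheme X Y S M :=
  fun a b => if a.1.1 = b.2 then Z.successKernel a.1.2 b.1 (ι a.1.2 a.2) else
    (Z.inputKernel a.1.2 b.1 (ι a.1.2 a.2) - Z.successKernel a.1.2 b.1 (ι a.1.2 a.2)) / (M - 1)

namespace Scheme

variable {X Y Y' S : Type*} [Fintype X] {M : ℕ} {Z : Scheme X Y' S M} (ι : S → Y → Y')

theorem sum_ite_eq_fin (hM : 0 < M) (w : Fin M) (a b : ℝ) :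
    ∑ w', (if w = w' then a else b) = a + (M - 1) * b := by
  rw [← Finset.add_sum_erase _ _ (Finset.mem_univ w), if_pos rfl,
    Finset.sum_congr rfl fun w' hw' => if_neg (Finset.mem_erase.1 hw').1.symm, Finset.sum_const,
    Finset.card_erase_of_mem (Finset.mem_univ w), Finset.card_univ, Fintype.card_fin, nsmul_eq_mul,
    Nat.cast_sub hM, Nat.cast_one]

theorem hideState_mem (hM : 0 < M) (hZ : Z ∈ nsSchemes X Y' S M) :
    Z.hideState ι ∈ nsSchemes X Y S M := by
  have h1 : ∀ w s y x, ∑ w', Z.hideState ι ((w, s), y) (x, w') = Z.inputKernel s x (ι s y) := by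
    intro w s y x
    simp only [hideState]
    rw [sum_ite_eq_fin hM]
    rcases Nat.eq_or_lt_of_le (Nat.succ_le_of_lt hM) with rfl | h
    · simp [successKernel, inputKernel]
    · have : (1 : ℝ) < M := by exact_mod_cast h
      rw [mul_div_cancel₀ _ (sub_pos.2 this).ne']
      ring
  -- Any fixed message is decoded with probability `1 / M`, whatever message is sent.
  have h2 : ∀ w s y w', ∑ x, Z.hideState ι ((w, s), y) (x, w') = 1 / M := by
    intro w s y w'
    simp only [hideState]
    split_ifs with h
    · exact sum_successKernel hM hZ s _
    · have hM1 : (1 : ℝ) < M := by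
        rcases Nat.eq_or_lt_of_le (Nat.succ_le_of_lt hM) with rfl | h'
        · exact absurd (Subsingleton.elim _ _) h
        · exact_mod_cast h'
      rw [← Finset.sum_div, Finset.sum_sub_distrib, sum_successKernel hM hZ,
        sum_inputKernel hM hZ]
      have := (sub_pos.2 hM1).ne'
      field_simp
  refine ⟨fun ⟨⟨w, s⟩, y⟩ => ⟨fun ⟨x, w'⟩ => ?_, ?_⟩, fun ⟨w, s⟩ y y' x => ?_,
    fun ⟨w, s⟩ ⟨w₁, s₁⟩ y w' => ?_⟩
  · simp only [hideState]
    split_ifs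
    · exact successKernel_nonneg hZ _ _ _
    · have : (1 : ℝ) ≤ M := by exact_mod_cast hM
      exact div_nonneg (sub_nonneg.2 (successKernel_le_inputKernel hZ _ _ _)) (sub_nonneg.2 this)
  · rw [Fintype.sum_prod_type]
    simp_rw [h1, sum_inputKernel hM hZ]
  · rw [h1, h1, inputKernel_congr hZ]
  · rw [h2, h2]

theorem successKernel_hideState {X Y Y' S : Type*} {M : ℕ} {Z : Scheme X Y' S M} (ι : S → Y → Y')
    (hM : 0 < M) (s : S) (x : X) (y : Y) :
    (Z.hideState ι).successKernel s x y = Z.successKernel s x (ι s y) := by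
  have : (M : ℝ) ≠ 0 := by positivity
  rw [successKernel]
  simp [hideState, this]

end Scheme

namespace StateChannel

/-- The output of `N̄` is the output of `N` together with the true state. -/
theorem sum_bar_pow_kernel_mul {X Y S : Type*} [Fintype Y] [Fintype S] [DecidableEq S]
    (N : StateChannel X Y S) {n : ℕ} (ξ : Fin n → X) (σ : Fin n → S)
    (F : (Fin n → Y × S) → ℝ) :
    ∑ z, (N.bar.pow n).kernel (ξ, σ) z * F z =
      ∑ y, (N.pow n).kernel (ξ, σ) y * F fun i => (y i, σ i) := by
  rw [← Fintype.sum_equiv (Equiv.arrowProdEquivProdArrow (Fin n) (fun _ => Y) (fun _ => S)).symm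
    (fun v => (N.bar.pow n).kernel (ξ, σ) (fun i => (v.1 i, v.2 i)) * F fun i => (v.1 i, v.2 i))
    _ (fun v => rfl), Fintype.sum_prod_type]
  refine Finset.sum_congr rfl fun y _ => ?_
  rw [Finset.sum_eq_single σ]
  · simp [pow, bar]
  · intro σ' _ hσ'
    obtain ⟨i, hi⟩ := Function.ne_iff.1 hσ'
    have : (N.bar.pow n).kernel (ξ, σ) (fun i => (y i, σ' i)) = 0 :=
      Finset.prod_eq_zero (Finset.mem_univ i) (by simp [bar, hi])
    rw [this, zero_mul]
  · simp

variable {X Y S : Type*} [Fintype X] [Fintype Y] [Fintype S] [DecidableEq S]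
  (N : StateChannel X Y S)

theorem successProb_hideState {n M : ℕ} (hM : 0 < M)
    (Z : Scheme (Fin n → X) (Fin n → Y × S) (Fin n → S) M) :
    (N.pow n).successProb (Z.hideState fun σ y i => (y i, σ i)) = (N.bar.pow n).successProb Z := by
  rw [successProb_eq, successProb_eq]
  refine Finset.sum_congr rfl fun σ _ => Finset.sum_congr rfl fun ξ _ => ?_
  simp_rw [mul_assoc, ← Finset.mul_sum, Scheme.successKernel_hideState _ hM]
  rw [sum_bar_pow_kernel_mul]
  rfl

theorem nsCapacity_bar_le : N.bar.nsCapacity ≤ N.nsCapacity := by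
  refine sSup_le_sSup (Set.image_mono ?_)
  rintro R ⟨hR, M, Z, L, hM, hZ, hη, hL, hRL⟩
  refine ⟨hR, M, fun n => (Z n).hideState fun σ y i => (y i, σ i), L, hM,
    fun n => Scheme.hideState_mem _ (hM n) (hZ n), ?_, hL, hRL⟩
  simpa only [N.successProb_hideState (hM _)] using hη

theorem classicalCapacity_le_nsCapacity {X Y S : Type*} [Fintype X] [Fintype Y] [Fintype S]
    (N : StateChannel X Y S) : N.classicalCapacity ≤ N.nsCapacity := by
  refine sSup_le_sSup (Set.image_mono ?_)
  rintro R ⟨hR, M, Z, L, hM, hZ, h⟩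
  exact ⟨hR, M, Z, L, hM, fun n => classicalSchemes_subset_nsSchemes _ _ _ _ (hZ n), h⟩

end StateChannel

/-! ### Random coding with the state known to the encoder and the decoder -/

theorem mem_classicalSchemes_of_fintype {X Y S Q : Type*} [Fintype X] [Fintype Q] {M : ℕ}
    {PQ : Q → ℝ} {E : Fin M × S × Q → X → ℝ} {D : Y × Q → Fin M → ℝ} (hQ : PQ ∈ stdSimplex ℝ Q)
    (hE : E ∈ condPMF (Fin M × S × Q) X) (hD : D ∈ condPMF (Y × Q) (Fin M)) :
    (fun a b => ∑ q, PQ q * E (a.1.1, a.1.2, q) b.1 * D (a.2, q) b.2 : Scheme X Y S M) ∈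
      classicalSchemes X Y S M := by
  let e := (Fintype.equivFin Q).symm
  refine ⟨Fin (Fintype.card Q), inferInstance, fun k => PQ (e k), fun a => E (a.1, a.2.1, e a.2.2),
    fun a => D (a.1, e a.2), ⟨fun k => hQ.1 _, (e.sum_comp PQ).trans hQ.2⟩, fun _ => hE _,
    fun _ => hD _, fun w s y x w' => ?_⟩
  exact (e.sum_comp fun q => PQ q * E (w, s, q) x * D (y, q) w').symm

theorem prod_mem_condPMF {X S : Type*} [Fintype X] {P : S → X → ℝ} (hP : P ∈ condPMF S X) (n : ℕ) :
    (fun σ ξ => ∏ i, P (σ i) (ξ i)) ∈ condPMF (Fin n → S) (Fin n → X) :=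
  fun σ => prod_mem_stdSimplex (fun i => P (σ i)) fun i => hP (σ i)

namespace StateChannel

variable {X Y S : Type*} [Fintype X] [Fintype Y] [Fintype S]
  (N : StateChannel X Y S) {P : S → X → ℝ}

open Classical in
/-- The message found by a threshold decoder with codebook `c`: one whose code word for the state
`s` has a likelihood above `γ` times the probability of the output `y`, if there is one. -/
noncomputable def thresholdDecode (P : S → X → ℝ) (γ : ℝ) {M : ℕ} (hM : 0 < M)
    (c : Fin M × S → X) (s : S) (y : Y) : Fin M :=
  if h : ∃ w, γ * N.outLaw P s y < N.kernel (c (w, s), s) y then h.choose else ⟨0, hM⟩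

open Classical in
/-- The decoder errs only if the sent message is below the threshold or another one is above it. -/
theorem le_thresholdDecode_indicator (P : S → X → ℝ) (γ : ℝ) {M : ℕ} (hM : 0 < M)
    (c : Fin M × S → X) (s : S) (y : Y) (w : Fin M) :
    1 - (if N.kernel (c (w, s), s) y ≤ γ * N.outLaw P s y then (1 : ℝ) else 0) -
        ∑ w' ∈ Finset.univ.erase w,
          (if γ * N.outLaw P s y < N.kernel (c (w', s), s) y then (1 : ℝ) else 0) ≤
      if w = N.thresholdDecode P γ hM c s y then 1 else 0 := by
  have h0 : ∀ w' ∈ Finset.univ.erase w,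
      (0 : ℝ) ≤ if γ * N.outLaw P s y < N.kernel (c (w', s), s) y then (1 : ℝ) else 0 :=
    fun w' _ => by split_ifs <;> norm_num
  have hsum := Finset.sum_nonneg h0
  by_cases hw : N.kernel (c (w, s), s) y ≤ γ * N.outLaw P s y
  · rw [if_pos hw]
    have : (0 : ℝ) ≤ if w = N.thresholdDecode P γ hM c s y then 1 else 0 := by
      split_ifs <;> norm_num
    linarith
  rw [if_neg hw]
  by_cases hd : w = N.thresholdDecode P γ hM c s y
  · rw [if_pos hd]
    linarith
  rw [if_neg hd]
  have hex : ∃ w, γ * N.outLaw P s y < N.kernel (c (w, s), s) y := ⟨w, not_le.1 hw⟩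
  have hspec : γ * N.outLaw P s y <
      N.kernel (c (N.thresholdDecode P γ hM c s y, s), s) y := by
    rw [thresholdDecode, dif_pos hex]
    exact hex.choose_spec
  have := Finset.single_le_sum h0
    (Finset.mem_erase.2 ⟨fun h => hd h.symm, Finset.mem_univ (N.thresholdDecode P γ hM c s y)⟩)
  rw [if_pos hspec] at this
  linarith

open Classical in
/-- The average over codebooks with independent entries `c (w, s) ∼ P(· ∣ s)` of the probability of
correct decoding of `w`, for a fixed state `s`. -/
theorem le_sum_codebook_mul_success (hP : P ∈ condPMF S X) {γ : ℝ} (hγ : 0 < γ) {M : ℕ}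
    (hM : 0 < M) (w : Fin M) (s : S) :
    1 - ∑ x, ∑ y, P s x * N.kernel (x, s) y *
        (if N.kernel (x, s) y ≤ γ * N.outLaw P s y then 1 else 0) - M / γ ≤
      ∑ y, ∑ c : Fin M × S → X, (∏ v, P v.2 (c v)) * (N.kernel (c (w, s), s) y *
        if w = N.thresholdDecode P γ hM c s y then 1 else 0) := by
  have hp : ∀ v : Fin M × S, (fun v : Fin M × S => P v.2) v ∈ stdSimplex ℝ X := fun v => hP v.2
  have hprod : ∀ c : Fin M × S → X, 0 ≤ ∏ v, P v.2 (c v) := fun c =>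
    Finset.prod_nonneg fun v _ => (hP _).1 _
  -- Another message is above the threshold with probability at most `1 / γ` (Markov).
  have hpair : ∀ y, ∀ w' ∈ Finset.univ.erase w,
      ∑ c : Fin M × S → X, (∏ v, P v.2 (c v)) * (N.kernel (c (w, s), s) y *
        if γ * N.outLaw P s y < N.kernel (c (w', s), s) y then 1 else 0) ≤
      N.outLaw P s y / γ := by
    intro y w' hw'
    have hne : (w, s) ≠ (w', s) := fun h => (Finset.mem_erase.1 hw').1 (Prod.ext_iff.1 h).1.symm
    rw [sum_prod_mul_apply_mul_apply hp hne (fun x => N.kernel (x, s) y)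
      (fun x => if γ * N.outLaw P s y < N.kernel (x, s) y then 1 else 0), le_div_iff₀ hγ, mul_assoc]
    change N.outLaw P s y * _ ≤ _
    rcases (N.outLaw_nonneg hP s y).eq_or_lt with h | h
    · rw [← h, zero_mul]
    refine mul_le_of_le_one_right h.le (le_of_mul_le_mul_left ?_ h)
    rw [mul_one, Finset.sum_mul, Finset.mul_sum]
    refine (Finset.sum_le_sum fun x _ => ?_ : _ ≤ ∑ x, P s x * N.kernel (x, s) y)
    rw [show ∀ a b : ℝ, N.outLaw P s y * (a * b * γ) = a * (γ * N.outLaw P s y * b) by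
      intro a b; ring]
    refine mul_le_mul_of_nonneg_left ?_ ((hP s).1 x)
    split_ifs with hx
    · rw [mul_one]; exact hx.le
    · rw [mul_zero]; exact (N.kernel_mem _).1 y
  have hy : ∀ y, N.outLaw P s y - ∑ x, P s x * N.kernel (x, s) y *
        (if N.kernel (x, s) y ≤ γ * N.outLaw P s y then 1 else 0) - M * (N.outLaw P s y / γ) ≤
      ∑ c : Fin M × S → X, (∏ v, P v.2 (c v)) * (N.kernel (c (w, s), s) y *
        if w = N.thresholdDecode P γ hM c s y then 1 else 0) := by
    intro y
    refine le_trans ?_ (Finset.sum_le_sum fun c _ => mul_le_mul_of_nonneg_left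
      (mul_le_mul_of_nonneg_left (N.le_thresholdDecode_indicator P γ hM c s y w)
        ((N.kernel_mem _).1 y)) (hprod c))
    simp_rw [mul_sub, mul_one, Finset.sum_sub_distrib, Finset.mul_sum]
    rw [sum_prod_mul_apply hp (w, s) (fun x => N.kernel (x, s) y),
      sum_prod_mul_apply hp (w, s) (fun x => N.kernel (x, s) y *
        if N.kernel (x, s) y ≤ γ * N.outLaw P s y then 1 else 0), Finset.sum_comm]
    have h := Finset.sum_le_sum (hpair y)
    rw [Finset.sum_const, nsmul_eq_mul, Finset.card_erase_of_mem (Finset.mem_univ w),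
      Finset.card_univ, Fintype.card_fin] at h
    have hM' : (((M - 1 : ℕ) : ℝ)) * (N.outLaw P s y / γ) ≤ M * (N.outLaw P s y / γ) :=
      mul_le_mul_of_nonneg_right (by exact_mod_cast Nat.sub_le M 1)
        (div_nonneg (N.outLaw_nonneg hP s y) hγ.le)
    simp only [← mul_assoc] at h ⊢
    change _ ≤ N.outLaw P s y - _ - _
    linarith
  refine le_trans (le_of_eq ?_) (Finset.sum_le_sum fun y _ => hy y)
  rw [Finset.sum_sub_distrib, Finset.sum_sub_distrib, N.sum_outLaw hP, ← Finset.mul_sum,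
    ← Finset.sum_div, N.sum_outLaw hP, mul_one_div, Finset.sum_comm]

open Classical in
/-- One-shot achievability when the output determines the state: `γ` is the decoding threshold on
the likelihood ratio. The codebook is the shared randomness of the scheme. -/
theorem exists_classicalScheme (hP : P ∈ condPMF S X) (τ : Y → S)
    (hτ : ∀ x s y, N.kernel (x, s) y ≠ 0 → τ y = s) {γ : ℝ} (hγ : 0 < γ) {M : ℕ} (hM : 0 < M) :
    ∃ Z ∈ classicalSchemes X Y S M,
      1 - ∑ s, ∑ x, ∑ y, N.jointLaw P (s, x, y) *
        (if N.kernel (x, s) y ≤ γ * N.outLaw P s y then 1 else 0) - M / γ ≤ N.successProb Z := by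
  refine ⟨_, mem_classicalSchemes_of_fintype (Q := Fin M × S → X)
    (PQ := fun c => ∏ v, P v.2 (c v)) (E := fun a => Pi.single (a.2.2 (a.1, a.2.1)) 1)
    (D := fun a => Pi.single (N.thresholdDecode P γ hM a.2 (τ a.1) a.1) 1)
    (prod_mem_stdSimplex (fun v : Fin M × S => P v.2) fun v => hP v.2)
    (fun _ => single_mem_stdSimplex ℝ _) (fun _ => single_mem_stdSimplex ℝ _), ?_⟩
  have hsucc : ∀ w s, ∑ x, ∑ y, N.stateLaw s * N.kernel (x, s) y *
      ∑ c : Fin M × S → X, (∏ v, P v.2 (c v)) * (Pi.single (c (w, s)) 1 : X → ℝ) x *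
        (Pi.single (N.thresholdDecode P γ hM c (τ y) y) 1 : Fin M → ℝ) w =
      N.stateLaw s * ∑ y, ∑ c : Fin M × S → X, (∏ v, P v.2 (c v)) * (N.kernel (c (w, s), s) y *
        if w = N.thresholdDecode P γ hM c s y then 1 else 0) := by
    intro w s
    rw [Finset.sum_comm, Finset.mul_sum]
    refine Finset.sum_congr rfl fun y _ => ?_
    simp_rw [Finset.mul_sum]
    rw [Finset.sum_comm]
    refine Finset.sum_congr rfl fun c _ => ?_
    rw [Finset.sum_eq_single (c (w, s))
      (fun x _ hx => by rw [Pi.single_eq_of_ne hx]; ring) (by simp), Pi.single_eq_same,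
      Pi.single_apply]
    by_cases hk : N.kernel (c (w, s), s) y = 0
    · rw [hk]; ring
    · rw [hτ _ _ _ hk]; ring
  have hw : ∀ w, 1 - ∑ s, ∑ x, ∑ y, N.jointLaw P (s, x, y) *
      (if N.kernel (x, s) y ≤ γ * N.outLaw P s y then 1 else 0) - M / γ ≤
      ∑ s, N.stateLaw s * ∑ y, ∑ c : Fin M × S → X, (∏ v, P v.2 (c v)) *
        (N.kernel (c (w, s), s) y *
          if w = N.thresholdDecode P γ hM c s y then 1 else 0) := by
    intro w
    refine le_trans (le_of_eq ?_) (Finset.sum_le_sum fun s _ => mul_le_mul_of_nonneg_left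
      (N.le_sum_codebook_mul_success hP hγ hM w s) (N.stateLaw_mem.1 s))
    simp only [mul_sub, Finset.sum_sub_distrib, ← Finset.sum_mul, N.stateLaw_mem.2, one_mul,
      mul_one]
    simp only [jointLaw, Finset.mul_sum, mul_assoc]
  have hlow : (M : ℝ) * (1 - ∑ s, ∑ x, ∑ y, N.jointLaw P (s, x, y) *
      (if N.kernel (x, s) y ≤ γ * N.outLaw P s y then 1 else 0) - M / γ) ≤
      ∑ w : Fin M, ∑ s, N.stateLaw s * ∑ y, ∑ c : Fin M × S → X, (∏ v, P v.2 (c v)) *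
        (N.kernel (c (w, s), s) y *
          if w = N.thresholdDecode P γ hM c s y then 1 else 0) := by
    refine le_trans (le_of_eq ?_) (Finset.sum_le_sum fun w _ => hw w)
    rw [Finset.sum_const, Finset.card_univ, Fintype.card_fin, nsmul_eq_mul]
  rw [successProb, one_div, inv_mul_eq_div, le_div_iff₀ (by positivity), mul_comm]
  refine hlow.trans_eq (Finset.sum_congr rfl fun w _ => Finset.sum_congr rfl fun s _ => ?_)
  rw [← hsucc w s]

theorem pow_outLaw {n : ℕ} (σ : Fin n → S) (y : Fin n → Y) :
    (N.pow n).outLaw (fun σ ξ => ∏ i, P (σ i) (ξ i)) σ y = ∏ i, N.outLaw P (σ i) (y i) :=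
  sum_prod_mul_prod (fun i => P (σ i)) (fun i x => N.kernel (x, σ i) (y i))

open Classical in
/-- The information density of `n` independent uses concentrates around `n I(X;Y∣S)`. -/
theorem sum_pow_jointLaw_lowerTail_le (hP : P ∈ condPMF S X) {ε : ℝ} (hε : 0 < ε) :
    ∃ V : ℝ, ∀ n : ℕ, 0 < n →
      ∑ σ, ∑ ξ, ∑ y, (N.pow n).jointLaw (fun σ ξ => ∏ i, P (σ i) (ξ i)) (σ, ξ, y) *
        (if (N.pow n).kernel (ξ, σ) y ≤ 2 ^ (n * (condMutualInfo (N.jointLaw P) - ε)) *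
          (N.pow n).outLaw (fun σ ξ => ∏ i, P (σ i) (ξ i)) σ y then 1 else 0) ≤ V / n := by
  obtain ⟨f, hf⟩ : ∃ f : S × X × Y → ℝ, ∀ s x y, f (s, x, y) =
      Real.logb 2 (N.kernel (x, s) y / N.outLaw P s y) :=
    ⟨fun t => Real.logb 2 (N.kernel (t.2.1, t.1) t.2.2 / N.outLaw P t.1 t.2.2),
      fun _ _ _ => rfl⟩
  have hI : ∑ t, N.jointLaw P t * f t = condMutualInfo (N.jointLaw P) := by
    simp_rw [N.condMutualInfo_jointLaw hP, Fintype.sum_prod_type, hf]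
  refine ⟨_, fun n hn => le_trans ?_ ((sum_prod_mul_lowerTail_le (ι := Fin n) (N.jointLaw_mem hP) f
    hε (by simpa using hn)).trans_eq (by rw [Fintype.card_fin]))⟩
  rw [sum_sum_sum_eq_sum_arrow (fun σ ξ y => (N.pow n).jointLaw
    (fun σ ξ => ∏ i, P (σ i) (ξ i)) (σ, ξ, y) * (if (N.pow n).kernel (ξ, σ) y ≤
      2 ^ (n * (condMutualInfo (N.jointLaw P) - ε)) *
        (N.pow n).outLaw (fun σ ξ => ∏ i, P (σ i) (ξ i)) σ y then 1 else 0))]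
  refine Finset.sum_le_sum fun u _ => ?_
  have hJ : (N.pow n).jointLaw (fun σ ξ => ∏ i, P (σ i) (ξ i))
      (fun i => (u i).1, fun i => (u i).2.1, fun i => (u i).2.2) = ∏ i, N.jointLaw P (u i) := by
    simp only [jointLaw, pow, ← Finset.prod_mul_distrib]
  rw [hJ]
  have hnn : ∀ i ∈ Finset.univ, 0 ≤ N.jointLaw P (u i) := fun i _ => N.jointLaw_nonneg hP (u i)
  rcases (Finset.prod_nonneg hnn).eq_or_lt with h0 | h0
  · rw [← h0, zero_mul, zero_mul]
  refine mul_le_mul_of_nonneg_left ?_ h0.le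
  have hpos : ∀ i, 0 < N.kernel ((u i).2.1, (u i).1) (u i).2.2 ∧
      0 < N.outLaw P (u i).1 (u i).2.2 := fun i =>
    (N.pos_of_jointLaw_pos hP ((hnn i (Finset.mem_univ i)).lt_of_ne'
      (Finset.prod_ne_zero_iff.1 h0.ne' i (Finset.mem_univ i)))).2.2
  have hiff : (N.pow n).kernel (fun i => (u i).2.1, fun i => (u i).1) (fun i => (u i).2.2) ≤
      2 ^ (n * (condMutualInfo (N.jointLaw P) - ε)) *
        (N.pow n).outLaw (fun σ ξ => ∏ i, P (σ i) (ξ i)) (fun i => (u i).1)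
          (fun i => (u i).2.2) →
      ∑ i, f (u i) ≤ Fintype.card (Fin n) * (∑ t, N.jointLaw P t * f t - ε) := by
    intro h
    rw [pow_outLaw, ← div_le_iff₀ (Finset.prod_pos fun i _ => (hpos i).2)] at h
    rw [hI, Fintype.card_fin]
    have hfu : ∑ i, f (u i) = Real.logb 2 ((∏ i, N.kernel ((u i).2.1, (u i).1) (u i).2.2) /
        ∏ i, N.outLaw P (u i).1 (u i).2.2) := by
      rw [← Finset.prod_div_distrib,
        Real.logb_prod _ _ fun i _ => (div_pos (hpos i).1 (hpos i).2).ne']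
      exact Finset.sum_congr rfl fun i _ => hf _ _ _
    rw [hfu, Real.logb_le_iff_le_rpow (by norm_num)
      (div_pos (Finset.prod_pos fun i _ => (hpos i).1) (Finset.prod_pos fun i _ => (hpos i).2))]
    exact h
  split_ifs with h1 h2
  · exact le_rfl
  · exact absurd (hiff h1) h2
  · exact zero_le_one
  · exact le_rfl

theorem successProb_le_one [Nonempty X] {M : ℕ} (hM : 0 < M) {Z : Scheme X Y S M}
    (hZ : Z ∈ nsSchemes X Y S M) : N.successProb Z ≤ 1 := by
  obtain ⟨P, hP, hPZ, -⟩ := N.exists_inputLaw hM hZ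
  have h := (N.jointLaw_mem hP).2
  simp_rw [Fintype.sum_prod_type] at h
  rw [← h, successProb_eq]
  refine Finset.sum_le_sum fun s _ => Finset.sum_le_sum fun x _ => Finset.sum_le_sum fun y _ => ?_
  rw [jointLaw, mul_right_comm _ (P s x), ← hPZ s x y]
  exact mul_le_mul_of_nonneg_left (Scheme.successKernel_le_inputKernel hZ s x y)
    (mul_nonneg (N.stateLaw_mem.1 s) ((N.kernel_mem _).1 y))

/-- Rounding up `2 ^ (n R)` does not change the rate. -/
theorem tendsto_logb_ceil_div {R : ℝ} (hR : 0 ≤ R) :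
    Tendsto (fun n : ℕ => Real.logb 2 (⌈(2 : ℝ) ^ (n * R)⌉₊) / n) atTop (𝓝 R) := by
  have hlim : Tendsto (fun n : ℕ => R + 1 / (n : ℝ)) atTop (𝓝 R) := by
    simpa using tendsto_const_nhds.add (tendsto_one_div_atTop_nhds_zero_nat (𝕜 := ℝ))
  refine tendsto_of_tendsto_of_tendsto_of_le_of_le' tendsto_const_nhds hlim ?_ ?_
  all_goals
    filter_upwards [eventually_gt_atTop 0] with n hn
    have hn' : (0 : ℝ) < n := by exact_mod_cast hn
    have h2 : (0 : ℝ) < 2 ^ (n * R) := by positivity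
    have hle := Nat.le_ceil ((2 : ℝ) ^ (n * R))
  · rw [le_div_iff₀ hn', mul_comm, Real.le_logb_iff_rpow_le (by norm_num) (h2.trans_le hle)]
    exact hle
  · rw [div_le_iff₀ hn', Real.logb_le_iff_le_rpow (by norm_num) (h2.trans_le hle)]
    have h1 : (1 : ℝ) ≤ 2 ^ (n * R) := Real.one_le_rpow (by norm_num) (by positivity)
    calc ((⌈(2 : ℝ) ^ (n * R)⌉₊ : ℕ) : ℝ) ≤ 2 ^ (n * R) + 1 :=
          (Nat.ceil_lt_add_one h2.le).le
      _ ≤ 2 ^ (n * R) * 2 := by linarith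
      _ = 2 ^ ((R + 1 / n) * n) := by
          rw [show (R + 1 / n) * n = n * R + 1 by field_simp, Real.rpow_add (by norm_num),
            Real.rpow_one]

/-- Every rate below the mutual information is achievable when the decoder sees the state. -/
theorem isAchievable_bar [Nonempty X] [DecidableEq S] (hP : P ∈ condPMF S X) {R : ℝ} (hR : 0 ≤ R)
    (hRC : R < condMutualInfo (N.jointLaw P)) :
    N.bar.IsAchievable (fun _ M => classicalSchemes _ _ _ M) R := by
  classical
  obtain ⟨ε, hε, hεR⟩ : ∃ ε > 0, condMutualInfo (N.bar.jointLaw P) - ε = R + ε := by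
    rw [N.condMutualInfo_bar_jointLaw hP]
    exact ⟨(condMutualInfo (N.jointLaw P) - R) / 2, by linarith, by ring⟩
  obtain ⟨V, hV⟩ := N.bar.sum_pow_jointLaw_lowerTail_le hP hε
  have hM : ∀ n : ℕ, 0 < ⌈(2 : ℝ) ^ (n * R)⌉₊ := fun n => Nat.ceil_pos.2 (by positivity)
  have hτ : ∀ (n : ℕ) (ξ : Fin n → X) (σ : Fin n → S) (y : Fin n → Y × S),
      (N.bar.pow n).kernel (ξ, σ) y ≠ 0 → (fun i => (y i).2) = σ := by
    intro n ξ σ y h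
    funext i
    have hi : N.bar.kernel (ξ i, σ i) (y i) ≠ 0 :=
      Finset.prod_ne_zero_iff.1 (show ∏ i, N.bar.kernel (ξ i, σ i) (y i) ≠ 0 from h) i
        (Finset.mem_univ i)
    by_contra hne
    exact hi (by simp [bar, hne])
  choose Z hZ hZη using fun n : ℕ => (N.bar.pow n).exists_classicalScheme (prod_mem_condPMF hP n)
    (fun y i => (y i).2) (hτ n) (γ := 2 ^ (n * (condMutualInfo (N.bar.jointLaw P) - ε)))
    (by positivity) (hM n)
  refine ⟨hR, _, Z, R, hM, hZ, ?_, tendsto_logb_ceil_div hR, le_rfl⟩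
  have hlim : Tendsto (fun n : ℕ => 1 - V / n - 2 * ((2 : ℝ) ^ (-ε)) ^ n) atTop
      (𝓝 (1 - 0 - 2 * 0)) := by
    refine (tendsto_const_nhds.sub (tendsto_const_div_atTop_nhds_zero_nat V)).sub
      ((tendsto_pow_atTop_nhds_zero_of_lt_one (by positivity) ?_).const_mul 2)
    exact Real.rpow_lt_one_of_one_lt_of_neg (by norm_num) (by linarith)
  rw [show (1 : ℝ) - 0 - 2 * 0 = 1 by norm_num] at hlim
  refine tendsto_of_tendsto_of_tendsto_of_le_of_le' hlim tendsto_const_nhds ?_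
    (Eventually.of_forall fun n => (N.bar.pow n).successProb_le_one (hM n)
      (classicalSchemes_subset_nsSchemes _ _ _ _ (hZ n)))
  filter_upwards [eventually_gt_atTop 0] with n hn
  refine le_trans ?_ (hZη n)
  have h1 : (1 : ℝ) ≤ 2 ^ (n * R) := Real.one_le_rpow (by norm_num) (by positivity)
  have hγ : (⌈(2 : ℝ) ^ (n * R)⌉₊ : ℝ) / 2 ^ (n * (condMutualInfo (N.bar.jointLaw P) - ε)) ≤
      2 * ((2 : ℝ) ^ (-ε)) ^ n := by
    rw [div_le_iff₀ (by positivity), hεR, ← Real.rpow_natCast, ← Real.rpow_mul (by norm_num),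
      mul_assoc, ← Real.rpow_add (by norm_num),
      show -ε * n + n * (R + ε) = n * R by ring]
    linarith [(Nat.ceil_lt_add_one (show (0 : ℝ) ≤ 2 ^ (n * R) by positivity)).le]
  linarith [hV n hn]

/-- With one message every scheme succeeds. -/
theorem isAchievable_zero [Nonempty X] :
    N.IsAchievable (fun _ M => classicalSchemes _ _ _ M) 0 := by
  classical
  refine ⟨le_rfl, fun _ => 1, fun n a b => if b.1 = Classical.arbitrary _ then 1 else 0, 0,
    fun _ => one_pos, fun n => ?_, ?_, by simp, le_rfl⟩
  · refine ⟨Unit, inferInstance, fun _ => 1, fun _ => Pi.single (Classical.arbitrary _) 1,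
      fun _ _ => 1, ⟨fun _ => zero_le_one, by simp⟩, fun _ => single_mem_stdSimplex ℝ _,
      fun _ => ⟨fun _ => zero_le_one, by simp⟩, fun w s y x w' => ?_⟩
    simp [Pi.single_apply]
  · refine tendsto_const_nhds.congr fun n => ?_
    simp only [successProb]
    have h : ∀ (σ : Fin n → S) (ξ : Fin n → X),
        ∑ y, (N.pow n).stateLaw σ * (N.pow n).kernel (ξ, σ) y = (N.pow n).stateLaw σ :=
      fun σ ξ => by rw [← Finset.mul_sum, ((N.pow n).kernel_mem _).2, mul_one]
    simp [h, (N.pow n).stateLaw_mem.2]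

theorem le_classicalCapacity_bar [Nonempty X] [DecidableEq S] (hP : P ∈ condPMF S X) :
    (condMutualInfo (N.jointLaw P) : EReal) ≤ N.bar.classicalCapacity := by
  have h0 : (0 : EReal) ≤ N.bar.classicalCapacity :=
    le_sSup ⟨0, N.bar.isAchievable_zero, EReal.coe_zero⟩
  refine le_of_forall_lt fun a ha => ?_
  rcases lt_or_ge a 0 with h | h
  · exact h.trans_le h0
  obtain ⟨b, hab, hb⟩ := EReal.lt_iff_exists_real_btwn.1 ha
  exact hab.trans_le (le_sSup ⟨b, N.isAchievable_bar hP
    (EReal.coe_nonneg.1 (h.trans hab.le)) (EReal.coe_lt_coe_iff.1 hb), rfl⟩)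

end StateChannel

/-! ### The capacities -/

theorem theorem2 {X Y S : Type*} [Fintype X] [Nonempty X] [Fintype Y] [Fintype S] [DecidableEq S]
    (N : StateChannel X Y S) :
    (∃ C : ℝ,
      IsGreatest ((fun P : S → X → ℝ => condMutualInfo (N.jointLaw P)) '' condPMF S X) C ∧
      N.nsCapacity = (C : EReal) ∧
      N.bar.classicalCapacity = (C : EReal) ∧
      N.bar.nsCapacity = (C : EReal)) ∧
    (∀ M : ℕ, 0 < M → ∀ Z ∈ nsSchemes X Y S M,
      N.successProb Z * Real.logb 2 M - Real.binEntropy (N.successProb Z) / Real.log 2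
        ≤ condMutualInfo (N.inducedLaw Z)) := by
  refine ⟨?_, fun M hM Z hZ => N.successProb_mul_logb_le hM hZ⟩
  obtain ⟨C, hC⟩ := N.exists_isGreatest_condMutualInfo
  obtain ⟨P, hP, hPC⟩ := hC.1
  have lower : (C : EReal) ≤ N.bar.classicalCapacity := hPC ▸ N.le_classicalCapacity_bar hP
  have mid : N.bar.classicalCapacity ≤ N.bar.nsCapacity := N.bar.classicalCapacity_le_nsCapacity
  have upper : N.nsCapacity ≤ C := N.nsCapacity_le fun P hP => hC.2 ⟨P, hP, rfl⟩
  exact ⟨C, hC, upper.antisymm ((lower.trans mid).trans N.nsCapacity_bar_le),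
    ((mid.trans N.nsCapacity_bar_le).trans upper).antisymm lower,
    (N.nsCapacity_bar_le.trans upper).antisymm (lower.trans mid)⟩
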